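/- **Conventions.** A dagger symmetric monoidal category is a symmetric monoidal category with a contravariant involution $f\mapsto f^\dagger$ that is the identity on objects, such that $(f\otimes g)^\dagger=f^\dagger\otimes g^\dagger$ and the coherence isomorphisms are unitary. A dagger compact category $\mathbf V$ is a dagger symmetric monoidal category with, for each object $A$, a chosen dual $A^*$ and morphisms $\eta_A\colon I\to A^*\otimes A$, $\varepsilon_A\colon A\otimes A^*\to I$ satisfying the snake equations and $\varepsilon_A^\dagger=\sigma_{A^*,A}\circ\eta_A$. Write $\top_A=\eta_A^\dagger\colon A^*\otimes A\to I$, and $f_*=(f^\dagger)^*\colon A^*\to B^*$ for $f\colon A\to B$. Coherence isomorphisms of the monoidal structure are suppressed. The *reshuffling map* $$\varphi_{A,B}\colon (A\otimes B)^*\otimes(A\otimes B)\to (A^*\otimes A)\otimes(B^*\otimes B)$$ is the canonical isomorphism $(A\otimes B)^*\cong B^*\otimes A^*\cong A^*\otimes B^*$ on the first factor followed by the exchange of the two middle factors. A morphism $A\to A$ is *positive* if it equals $h^\dagger\circ h$ for some $h\colon A\to X$, and *positive definite* if moreover it is invertible. $\mathbf V$ is *positive-dimensional* if for every object $X$ there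 is a positive definite $z\colon I\to I$ with $(z^2\circ \top_X\circ\eta_X)\otimes 1_X=1_X$. **$\mathbf{CPM}[\mathbf V]$.** Its objects are those of $\mathbf V$. Its morphisms $A\to B$ are the morphisms $f\colon A^*\otimes A\to B^*\otimes B$ of $\mathbf V$ of the form $$f=(\top_X\otimes 1_{B^*\otimes B})\circ\varphi_{X,B}\circ(g_*\otimes g)\qquad(\ast)$$ for some object $X$ and some $g\colon A\to X\otimes B$. Composition, identities and daggers are those of $\mathbf V$; on objects $\otimes$ is that of $\mathbf V$; the tensor product of the morphisms $f\colon A\to B$ and $f'\colon A'\to B'$ is $\varphi_{B,B'}^{-1}\circ(f\otimes f')\circ\varphi_{A,A'}$; the coherence isomorphisms are $u_*\otimes u$ for the coherence isomorphisms $u$ of $\mathbf V$. This is a dagger symmetric monoidal category. **$\mathbf{CP}^*[\mathbf V]$.** A *dagger Frobenius algebra* is a monoid $(A,m,u)$ in $\mathbf V$ with $(1\otimes m)\circ(m^\dagger\otimes 1)=(m\otimes 1)\circ(1\otimes m^\dagger)$. Its *coaction* is $c_A=(1_{A^*}\otimes m)\circ(\eta_A\otimes 1_A)\colon A\to A^*\otimes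 A$. It is *normalisable* if there is a positive definite $z\colon A\to A$ that is central, i.e. $m\circ(z\otimes1)=z\circ m=m\circ(1\otimes z)$, with $\top_A\circ c_A\circ z^2=u^\dagger$. The objects of $\mathbf{CP}^*[\mathbf V]$ are the normalisable dagger Frobenius algebras in $\mathbf V$; its morphisms $(A,m,u)\to(B,m',u')$ are the morphisms $f\colon A\to B$ of $\mathbf V$ such that $c_B\circ f\circ c_A^\dagger\colon A^*\otimes A\to B^*\otimes B$ is of the form $(\ast)$ for some $X$ and some $g\colon A\to X\otimes B$. Composition, tensor product (with the usual tensor product of algebras), coherence isomorphisms and dagger are those of $\mathbf V$. This is a dagger symmetric monoidal category. **Theorem.** Let $\mathbf V$ be a positive-dimensional dagger compact category. For every object $A$, the object $A^*\otimes A$ with the *pants* multiplication $1_{A^*}\otimes\varepsilon_A\otimes1_A\colon (A^*\otimes A)\otimes(A^*\otimes A)\to A^*\otimes A$ and unit $\eta_A$ is a normalisable dagger Frobenius algebra $\mathcal B(A)$; and every morphism $f\colon A\to B$ of $\mathbf{CPM}[\mathbf V]$ is a morphism $\mathcal B(f)=f\colon\mathcal B(A)\to\mathcal B(B)$ of $\mathbf{CP}^*[\mathbf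 V]$. The resulting functor $\mathcal B\colon\mathbf{CPM}[\mathbf V]\to\mathbf{CP}^*[\mathbf V]$ is full and faithful and satisfies $\mathcal B(f^\dagger)=\mathcal B(f)^\dagger$. It is a dagger symmetric (strong) monoidal functor whose coherence isomorphisms are unitary in $\mathbf{CP}^*[\mathbf V]$ and are given by the reshuffling maps $\varphi_{A,B}\colon\mathcal B(A\otimes B)\to\mathcal B(A)\otimes\mathcal B(B)$ and by $\top_I=\eta_I^\dagger\colon\mathcal B(I)\to I$. -/

import Mathlib

open CategoryTheory MonoidalCategory

universe v u

/-- A dagger on a category: an involutive contravariant functor that is the identity on objects. -/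
class DaggerCategory (V : Type u) [Category.{v} V] where
  dag : ∀ {X Y : V}, (X ⟶ Y) → (Y ⟶ X)
  dag_id : ∀ X : V, dag (𝟙 X) = 𝟙 X
  dag_comp : ∀ {X Y Z : V} (f : X ⟶ Y) (g : Y ⟶ Z), dag (f ≫ g) = dag g ≫ dag f
  dag_dag : ∀ {X Y : V} (f : X ⟶ Y), dag (dag f) = f

/-- The dagger of a morphism. -/
postfix:max "†" => DaggerCategory.dag

/-- A dagger symmetric monoidal category: the dagger is compatible with the tensor product of
morphisms, and the coherence isomorphisms are unitary. -/
class DaggerSymmetricCategory (V : Type u) [Category.{v} V] [MonoidalCategory V]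
    [SymmetricCategory V] extends DaggerCategory V where
  dag_tensor : ∀ {X Y X' Y' : V} (f : X ⟶ Y) (g : X' ⟶ Y'), (f ⊗ₘ g)† = f† ⊗ₘ g†
  dag_associator : ∀ X Y Z : V, (α_ X Y Z).hom† = (α_ X Y Z).inv
  dag_leftUnitor : ∀ X : V, (λ_ X).hom† = (λ_ X).inv
  dag_rightUnitor : ∀ X : V, (ρ_ X).hom† = (ρ_ X).inv
  dag_braiding : ∀ X Y : V, (β_ X Y).hom† = (β_ X Y).inv

/-- A dagger compact category. Here `ᘁA = A*` is the chosen dual of `A`, with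
`η_ (ᘁA) A : I ⟶ A* ⊗ A` and `ε_ (ᘁA) A : A ⊗ A* ⟶ I` satisfying the snake equations; the dagger of
the cap is the cup, up to the symmetry. -/
class DaggerCompactCategory (V : Type u) [Category.{v} V] [MonoidalCategory V]
    [SymmetricCategory V] [LeftRigidCategory V] extends DaggerSymmetricCategory V where
  dag_evaluation : ∀ A : V, (ε_ (HasLeftDual.leftDual A) A)† =
    η_ (HasLeftDual.leftDual A) A ≫ (β_ (HasLeftDual.leftDual A) A).hom

set_option linter.unusedSectionVars false

namespace CPS

attribute [simp] DaggerCategory.dag_id DaggerCategory.dag_comp DaggerCategory.dag_dag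
  DaggerSymmetricCategory.dag_tensor DaggerSymmetricCategory.dag_associator
  DaggerSymmetricCategory.dag_leftUnitor DaggerSymmetricCategory.dag_rightUnitor
  DaggerSymmetricCategory.dag_braiding

section Dagger

variable {V : Type u} [Category.{v} V] [MonoidalCategory V] [SymmetricCategory V]
  [DaggerSymmetricCategory V]

theorem dag_inj {X Y : V} {f g : X ⟶ Y} (h : f† = g†) : f = g := by
  rw [← DaggerCategory.dag_dag f, h, DaggerCategory.dag_dag]

@[simp] theorem dag_associator_inv (X Y Z : V) : (α_ X Y Z).inv† = (α_ X Y Z).hom := by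
  rw [← DaggerSymmetricCategory.dag_associator, DaggerCategory.dag_dag]

@[simp] theorem dag_leftUnitor_inv (X : V) : (λ_ X).inv† = (λ_ X).hom := by
  rw [← DaggerSymmetricCategory.dag_leftUnitor, DaggerCategory.dag_dag]

@[simp] theorem dag_rightUnitor_inv (X : V) : (ρ_ X).inv† = (ρ_ X).hom := by
  rw [← DaggerSymmetricCategory.dag_rightUnitor, DaggerCategory.dag_dag]

@[simp] theorem dag_braiding_inv (X Y : V) : (β_ X Y).inv† = (β_ X Y).hom := by
  rw [← DaggerSymmetricCategory.dag_braiding, DaggerCategory.dag_dag]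

@[simp] theorem dag_whiskerLeft (X : V) {Y Z : V} (f : Y ⟶ Z) : (X ◁ f)† = X ◁ f† := by
  rw [← id_tensorHom, DaggerSymmetricCategory.dag_tensor, DaggerCategory.dag_id, id_tensorHom]

@[simp] theorem dag_whiskerRight {Y Z : V} (f : Y ⟶ Z) (X : V) : (f ▷ X)† = f† ▷ X := by
  rw [← tensorHom_id, DaggerSymmetricCategory.dag_tensor, DaggerCategory.dag_id, tensorHom_id]

theorem dag_tensorμ (W X Y Z : V) : (tensorμ W X Y Z)† = tensorδ W X Y Z := by
  simp [tensorμ, tensorδ]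

theorem dag_tensorδ (W X Y Z : V) : (tensorδ W X Y Z)† = tensorμ W X Y Z := by
  simp [tensorμ, tensorδ]

end Dagger

variable {V : Type u} [Category.{v} V] [MonoidalCategory V] [SymmetricCategory V]
  [LeftRigidCategory V]

/-- The chosen dual `A*`. -/
abbrev dual (A : V) : V := HasLeftDual.leftDual A

/-- `A ↦ A* ⊗ A`. -/
abbrev dbl (A : V) : V := dual A ⊗ A

/-- The cup `η_A : I ⟶ A* ⊗ A`. -/
def cup (A : V) : 𝟙_ V ⟶ dbl A := η_ (dual A) A

/-- The cap `ε_A : A ⊗ A* ⟶ I`. -/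
def cap (A : V) : A ⊗ dual A ⟶ 𝟙_ V := ε_ (dual A) A

theorem snake_left (A : V) :
    cup A ▷ dual A ≫ (α_ _ _ _).hom ≫ dual A ◁ cap A = (λ_ _).hom ≫ (ρ_ _).inv :=
  ExactPairing.evaluation_coevaluation _ _

theorem snake_right (A : V) :
    A ◁ cup A ≫ (α_ _ _ _).inv ≫ cap A ▷ A = (ρ_ _).hom ≫ (λ_ _).inv :=
  ExactPairing.coevaluation_evaluation _ _

/-- Morphisms out of a dual are determined by their composition with the cup. -/
theorem cup_ext {A Z : V} {f g : dual A ⟶ Z} (h : cup A ≫ f ▷ A = cup A ≫ g ▷ A) : f = g := by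
  have := congrArg (tensorRightHomEquiv _ (dual A) A _).symm h
  simp only [cup] at this
  rw [tensorRightHomEquiv_symm_coevaluation_comp_whiskerRight,
    tensorRightHomEquiv_symm_coevaluation_comp_whiskerRight] at this
  simpa using this

/-- The canonical isomorphism `(A ⊗ B)* ≅ A* ⊗ B*`: the canonical isomorphism
`(A ⊗ B)* ≅ B* ⊗ A*` followed by the symmetry. -/
def dualTensor (A B : V) : dual (A ⊗ B) ≅ dual A ⊗ dual B :=
  leftDualTensorIso A B ≪≫ β_ (dual B) (dual A)

theorem tensorμ_aux (A B : V) {Z W : V} (c : 𝟙_ V ⟶ Z ⊗ A) (d : 𝟙_ V ⟶ W ⊗ B) :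
    (d ⊗≫ (W ◁ c) ▷ B ⊗≫ 𝟙 ((W ⊗ Z) ⊗ (A ⊗ B))) ≫ (β_ W Z).hom ▷ (A ⊗ B) ≫ tensorμ Z W A B =
      (λ_ _).inv ≫ (c ⊗ₘ d) := by
  calc _ = d ⊗≫ (W ◁ c) ▷ B ⊗≫ ((β_ W Z).hom ▷ A ⊗≫ Z ◁ (β_ W A).hom) ▷ B ⊗≫ 𝟙 _ := by
        dsimp only [tensorμ]; monoidal
    _ = d ⊗≫ ((W ◁ c) ≫ (β_ W (Z ⊗ A)).hom) ▷ B ⊗≫ 𝟙 _ := by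
        rw [BraidedCategory.braiding_tensor_right_hom]; monoidal
    _ = d ⊗≫ (β_ W (𝟙_ V)).hom ▷ B ⊗≫ c ▷ (W ⊗ B) := by
        rw [BraidedCategory.braiding_naturality_right]; monoidal
    _ = 𝟙 _ ⊗≫ (𝟙_ V ◁ d ≫ c ▷ (W ⊗ B)) ⊗≫ 𝟙 _ := by
        rw [braiding_tensorUnit_right]; monoidal
    _ = _ := by
        rw [whisker_exchange, MonoidalCategory.tensorHom_def]; monoidal

theorem cup_dualTensor (A B : V) :
    cup (A ⊗ B) ≫ (dualTensor A B).hom ▷ (A ⊗ B) ≫ tensorμ (dual A) (dual B) A B =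
      (λ_ _).inv ≫ (cup A ⊗ₘ cup B) := by
  have h : cup (A ⊗ B) ≫ (leftDualTensorIso A B).hom ▷ (A ⊗ B) =
      η_ (dual B) B ⊗≫ (dual B ◁ η_ (dual A) A) ▷ B ⊗≫ 𝟙 _ := by
    exact (@coevaluation_comp_leftAdjointMate V _ _ (A ⊗ B) (A ⊗ B)
      (@HasLeftDual.mk V _ _ (A ⊗ B) (dual B ⊗ dual A) ExactPairing.tensor) _ (𝟙 (A ⊗ B))).trans
        (by rw [whiskerLeft_id, Category.comp_id]; rfl)
  rw [← tensorμ_aux]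
  simp only [dualTensor, Iso.trans_hom, comp_whiskerRight, Category.assoc]
  rw [reassoc_of% h]
  rfl

theorem tensorμ_aux' (A B : V) {Z W : V} (c : A ⊗ Z ⟶ 𝟙_ V) (d : B ⊗ W ⟶ 𝟙_ V) :
    (A ⊗ B) ◁ (β_ W Z).hom ≫ tensorμ A B Z W ≫ (c ⊗ₘ d) ≫ (λ_ _).hom =
    (𝟙 ((A ⊗ B) ⊗ (W ⊗ Z)) ⊗≫ A ◁ (d ▷ Z) ⊗≫ c) := by
  calc _ = 𝟙 ((A ⊗ B) ⊗ (W ⊗ Z)) ⊗≫ A ◁ (B ◁ (β_ W Z).hom ⊗≫ (β_ B Z).hom ▷ W) ⊗≫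
          ((A ⊗ Z) ◁ d ≫ c ▷ _) ⊗≫ 𝟙 _ := by
        rw [MonoidalCategory.tensorHom_def', tensorμ]; monoidal
    _ = 𝟙 ((A ⊗ B) ⊗ (W ⊗ Z)) ⊗≫ A ◁ ((β_ (B ⊗ W) Z).hom ≫ Z ◁ d) ⊗≫ c ⊗≫ 𝟙 _ := by
        rw [BraidedCategory.braiding_tensor_left_hom]; monoidal
    _ = 𝟙 ((A ⊗ B) ⊗ (W ⊗ Z)) ⊗≫ A ◁ (d ▷ Z) ⊗≫ A ◁ (β_ (𝟙_ V) Z).hom ⊗≫ c ⊗≫ 𝟙 _ := by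
        rw [← BraidedCategory.braiding_naturality_left]; monoidal
    _ = _ := by
        rw [braiding_tensorUnit_left]; monoidal

theorem cap_dualTensor (A B : V) :
    (A ⊗ B) ◁ (dualTensor A B).hom ≫ tensorμ A B (dual A) (dual B) ≫ (cap A ⊗ₘ cap B) ≫
      (λ_ _).hom = cap (A ⊗ B) := by
  have h : (A ⊗ B) ◁ (leftDualTensorIso A B).hom ≫
      (𝟙 _ ⊗≫ A ◁ (ε_ (dual B) B ▷ dual A) ⊗≫ ε_ (dual A) A) = cap (A ⊗ B) := by
    exact (@leftAdjointMate_comp_evaluation V _ _ (A ⊗ B) (A ⊗ B)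
      (@HasLeftDual.mk V _ _ (A ⊗ B) (dual B ⊗ dual A) ExactPairing.tensor) _ (𝟙 (A ⊗ B))).trans
        (by rw [id_whiskerRight, Category.id_comp]; rfl)
  rw [← h]
  simp only [dualTensor, Iso.trans_hom, whiskerLeft_comp, Category.assoc]
  rw [tensorμ_aux']
  rfl

theorem tensorμ_braiding (A B C D : V) :
    tensorμ A B C D ≫ (β_ (A ⊗ C) (B ⊗ D)).hom =
      ((β_ A B).hom ⊗ₘ (β_ C D).hom) ≫ tensorμ B A D C := by
  simp [tensorμ, SymmetricCategory.braiding_swap_eq_inv_braiding C B,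
    MonoidalCategory.tensorHom_def]

theorem tensorδ_eq (A B C D : V) : tensorδ A B C D = tensorμ A C B D := by
  simp only [tensorμ, tensorδ, SymmetricCategory.braiding_swap_eq_inv_braiding B C]

instance (A B C D : V) : IsIso (tensorμ A B C D) :=
  ⟨tensorδ A B C D, tensorμ_tensorδ _ _ _ _, tensorδ_tensorμ _ _ _ _⟩

theorem braiding_tensorμ (A B C D : V) :
    (β_ (A ⊗ B) (C ⊗ D)).hom ≫ tensorμ C D A B =
      tensorμ A B C D ≫ ((β_ A C).hom ⊗ₘ (β_ B D).hom) := by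
  rw [← cancel_epi (tensorμ A C B D), reassoc_of% (tensorμ_braiding A C B D), ← tensorδ_eq C A D B,
    tensorμ_tensorδ, ← tensorδ_eq A C B D, tensorμ_tensorδ_assoc, Category.comp_id]

variable [DaggerCompactCategory V]

/-- The discarding map `A* ⊗ A ⟶ I`, the dagger of the cup. -/
def disc (A : V) : dbl A ⟶ 𝟙_ V := (cup A)†

theorem dag_cup (A : V) : (cup A)† = disc A := rfl

theorem dag_disc (A : V) : (disc A)† = cup A := DaggerCategory.dag_dag _

theorem dag_cap (A : V) : (cap A)† = cup A ≫ (β_ (dual A) A).hom :=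
  DaggerCompactCategory.dag_evaluation A

theorem cap_eq (A : V) : cap A = (β_ A (dual A)).hom ≫ disc A := by
  apply dag_inj
  rw [dag_cap, DaggerCategory.dag_comp, dag_disc, DaggerSymmetricCategory.dag_braiding,
    ← SymmetricCategory.braiding_swap_eq_inv_braiding]

/-- The lower star (conjugate) `f_* = (f†)^* : A* ⟶ B*` of `f : A ⟶ B`. -/
def conj {A B : V} (f : A ⟶ B) : dual A ⟶ dual B := leftAdjointMate (f†)

@[simp] theorem conj_id (A : V) : conj (𝟙 A) = 𝟙 (dual A) := by
  simp [conj]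

theorem conj_comp {A B C : V} (f : A ⟶ B) (g : B ⟶ C) : conj (f ≫ g) = conj f ≫ conj g := by
  simp [conj, comp_leftAdjointMate]

theorem cup_conj {A B : V} (f : A ⟶ B) : cup A ≫ conj f ▷ A = cup B ≫ dual B ◁ f† :=
  coevaluation_comp_leftAdjointMate (f†)

theorem cup_conj_assoc {A B Z : V} (f : A ⟶ B) (h : dual B ⊗ A ⟶ Z) :
    cup A ≫ conj f ▷ A ≫ h = cup B ≫ dual B ◁ f† ≫ h := by
  rw [reassoc_of% (cup_conj f)]

theorem conj_cap {A B : V} (f : A ⟶ B) : B ◁ conj f ≫ cap B = f† ▷ _ ≫ cap A :=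
  leftAdjointMate_comp_evaluation (f†)

theorem conj_disc {A B : V} (f : A ⟶ B) : conj f ▷ B ≫ disc B = dual A ◁ f† ≫ disc A := by
  have h := conj_cap f
  rw [cap_eq, cap_eq, BraidedCategory.braiding_naturality_right_assoc,
    BraidedCategory.braiding_naturality_left_assoc] at h
  exact (cancel_epi _).1 h

theorem disc_ext {A Z : V} {f g : Z ⟶ dual A} (h : f ▷ A ≫ disc A = g ▷ A ≫ disc A) : f = g := by
  apply dag_inj
  apply cup_ext
  apply dag_inj
  simpa [dag_cup] using h

@[simp] theorem dag_conj {A B : V} (f : A ⟶ B) : (conj f)† = conj (f†) := by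
  apply disc_ext
  apply dag_inj
  have := cup_conj f
  simp [dag_disc]
  rw [this]
  apply dag_inj
  simp [dag_cup, conj_disc]

theorem cup_conj' {A B : V} (f : A ⟶ B) :
    cup A ≫ (conj f ⊗ₘ f) = cup B ≫ dual B ◁ (f† ≫ f) := by
  rw [MonoidalCategory.tensorHom_def, cup_conj_assoc, whiskerLeft_comp]

theorem dag_dualTensor (A B : V) : (dualTensor A B).hom† = (dualTensor A B).inv := by
  apply disc_ext
  rw [← cancel_epi ((dualTensor A B).hom ▷ (A ⊗ B)), ← comp_whiskerRight_assoc,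
    ← comp_whiskerRight_assoc, Iso.hom_inv_id, id_whiskerRight, Category.id_comp]
  have h1 := congrArg DaggerCategory.dag (cup_dualTensor A B)
  simp only [DaggerCategory.dag_comp, dag_cup, dag_whiskerRight, dag_tensorμ,
    DaggerSymmetricCategory.dag_tensor, dag_leftUnitor_inv, Category.assoc] at h1
  have h2 : (dualTensor A B).hom† ▷ (A ⊗ B) ≫ disc (A ⊗ B) =
      tensorμ _ _ _ _ ≫ (disc A ⊗ₘ disc B) ≫ (λ_ _).hom := by
    rw [← h1, tensorμ_tensorδ_assoc]
  have h3 := cap_dualTensor A B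
  simp only [cap_eq] at h3
  rw [comp_whiskerRight_assoc, h2]
  rw [← cancel_epi (β_ _ _).hom, ← h3, ← BraidedCategory.braiding_naturality_right_assoc]
  rw [reassoc_of% (braiding_tensorμ A B (dual A) (dual B))]
  simp

/-- The doubling `f_* ⊗ f : A* ⊗ A ⟶ B* ⊗ B` of `f : A ⟶ B`. -/
def double {A B : V} (f : A ⟶ B) : dbl A ⟶ dbl B := conj f ⊗ₘ f

@[simp] theorem double_id (A : V) : double (𝟙 A) = 𝟙 (dbl A) := by
  simp [double]

theorem double_comp {A B C : V} (f : A ⟶ B) (g : B ⟶ C) :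
    double (f ≫ g) = double f ≫ double g := by
  simp [double, conj_comp]

theorem double_comp_assoc {A B C Z : V} (f : A ⟶ B) (g : B ⟶ C) (h : dbl C ⟶ Z) :
    double (f ≫ g) ≫ h = double f ≫ double g ≫ h := by
  rw [double_comp, Category.assoc]

@[simp] theorem dag_double {A B : V} (f : A ⟶ B) : (double f)† = double (f†) := by
  simp [double]

/-- The reshuffling isomorphism `(A ⊗ B)* ⊗ (A ⊗ B) ≅ (A* ⊗ A) ⊗ (B* ⊗ B)`. -/
def resh (A B : V) : dbl (A ⊗ B) ≅ dbl A ⊗ dbl B where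
  hom := (dualTensor A B).hom ▷ (A ⊗ B) ≫ tensorμ (dual A) (dual B) A B
  inv := tensorδ (dual A) (dual B) A B ≫ (dualTensor A B).inv ▷ (A ⊗ B)

theorem dag_resh (A B : V) : (resh A B).hom† = (resh A B).inv := by
  simp [resh, dag_tensorμ, dag_dualTensor]

theorem dag_resh_inv (A B : V) : (resh A B).inv† = (resh A B).hom := by
  rw [← dag_resh, DaggerCategory.dag_dag]

theorem cup_resh (A B : V) :
    cup (A ⊗ B) ≫ (resh A B).hom = (λ_ _).inv ≫ (cup A ⊗ₘ cup B) := cup_dualTensor A B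

theorem disc_tensor (A B : V) :
    disc (A ⊗ B) = (resh A B).hom ≫ (disc A ⊗ₘ disc B) ≫ (λ_ _).hom := by
  rw [← Iso.inv_comp_eq, ← dag_resh]
  simpa [dag_cup] using congrArg DaggerCategory.dag (cup_resh A B)

theorem dualTensor_natural {A B A' B' : V} (f : A ⟶ A') (g : B ⟶ B') :
    conj (f ⊗ₘ g) ≫ (dualTensor A' B').hom = (dualTensor A B).hom ≫ (conj f ⊗ₘ conj g) := by
  apply cup_ext
  rw [← cancel_mono (tensorμ _ _ _ _)]
  simp only [comp_whiskerRight, Category.assoc]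
  rw [cup_conj_assoc, DaggerSymmetricCategory.dag_tensor, whisker_exchange_assoc,
    tensorμ_natural_right, reassoc_of% (cup_dualTensor A' B'), tensorμ_natural_left,
    reassoc_of% (cup_dualTensor A B)]
  simp [cup_conj]

theorem resh_natural {A B A' B' : V} (f : A ⟶ A') (g : B ⟶ B') :
    double (f ⊗ₘ g) ≫ (resh A' B').hom =
      (resh A B).hom ≫ (double f ⊗ₘ double g) := by
  simp only [double, resh, Category.assoc]
  rw [← tensorμ_natural, ← tensorHom_id, ← tensorHom_id, tensorHom_comp_tensorHom_assoc,
    tensorHom_comp_tensorHom_assoc, dualTensor_natural]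
  simp

theorem dualTensor_assoc (A B C : V) :
    conj (α_ A B C).hom ≫ (dualTensor A (B ⊗ C)).hom ≫ dual A ◁ (dualTensor B C).hom =
      (dualTensor (A ⊗ B) C).hom ≫ (dualTensor A B).hom ▷ dual C ≫ (α_ _ _ _).hom := by
  apply cup_ext
  rw [← cancel_mono (_ ◁ (α_ A B C).hom), ← cancel_mono (tensorμ _ _ _ _),
    ← cancel_mono (_ ◁ tensorμ _ _ _ _)]
  have hl : cup ((A ⊗ B) ⊗ C) ≫ conj (α_ A B C).hom ▷ ((A ⊗ B) ⊗ C) =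
      cup (A ⊗ B ⊗ C) ≫ _ ◁ (α_ A B C).inv := by
    rw [cup_conj, DaggerSymmetricCategory.dag_associator]
  have h1 : (dual A ◁ (dualTensor B C).hom) ▷ (A ⊗ B ⊗ C) ≫
      tensorμ (dual A) (dual B ⊗ dual C) A (B ⊗ C) =
      tensorμ (dual A) (dual (B ⊗ C)) A (B ⊗ C) ≫
        _ ◁ ((dualTensor B C).hom ▷ (B ⊗ C)) := by
    have := tensorμ_natural_left (𝟙 (dual A)) (dualTensor B C).hom A (B ⊗ C)
    simpa using this
  have h2 : ((dualTensor A B).hom ▷ dual C) ▷ ((A ⊗ B) ⊗ C) ≫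
      tensorμ (dual A ⊗ dual B) (dual C) (A ⊗ B) C =
      tensorμ (dual (A ⊗ B)) (dual C) (A ⊗ B) C ≫
        ((dualTensor A B).hom ▷ (A ⊗ B)) ▷ _ := by
    have := tensorμ_natural_left (dualTensor A B).hom (𝟙 (dual C)) (A ⊗ B) C
    simpa using this
  have h3 := associator_monoidal (dual A) (dual B) (dual C) A B C
  rw [MonoidalCategory.tensorHom_def] at h3
  simp only [Category.assoc] at h3
  simp only [comp_whiskerRight, Category.assoc]
  rw [reassoc_of% hl]
  have e1 : ∀ {Z} (k : _ ⟶ Z), cup (A ⊗ B ⊗ C) ≫ (dualTensor A (B ⊗ C)).hom ▷ _ ≫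
      tensorμ (dual A) (dual (B ⊗ C)) A (B ⊗ C) ≫ k = (λ_ _).inv ≫ (cup A ⊗ₘ cup (B ⊗ C)) ≫ k :=
    fun k => by rw [reassoc_of% (cup_dualTensor A (B ⊗ C))]
  have e2 : ∀ {Z} (k : _ ⟶ Z), cup ((A ⊗ B) ⊗ C) ≫ (dualTensor (A ⊗ B) C).hom ▷ _ ≫
      tensorμ (dual (A ⊗ B)) (dual C) (A ⊗ B) C ≫ k = (λ_ _).inv ≫ (cup (A ⊗ B) ⊗ₘ cup C) ≫ k :=
    fun k => by rw [reassoc_of% (cup_dualTensor (A ⊗ B) C)]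
  rw [← h3, reassoc_of% h2, e2]
  simp only [← whisker_exchange_assoc]
  rw [whiskerLeft_inv_hom_assoc, reassoc_of% h1, e1]
  have l1 : (cup A ⊗ₘ cup (B ⊗ C)) ≫ (dual A ⊗ A) ◁ (dualTensor B C).hom ▷ (B ⊗ C) ≫
      (dual A ⊗ A) ◁ tensorμ (dual B) (dual C) B C =
      (cup A ⊗ₘ ((λ_ _).inv ≫ (cup B ⊗ₘ cup C))) := by
    rw [← cup_dualTensor, ← whiskerLeft_comp, ← id_tensorHom, tensorHom_comp_tensorHom,
      Category.comp_id]
  have l2 : (cup (A ⊗ B) ⊗ₘ cup C) ≫ (dualTensor A B).hom ▷ (A ⊗ B) ▷ (dual C ⊗ C) ≫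
      tensorμ (dual A) (dual B) A B ▷ (dual C ⊗ C) ≫ (α_ _ _ _).hom =
      (((λ_ _).inv ≫ (cup A ⊗ₘ cup B)) ⊗ₘ cup C) ≫ (α_ _ _ _).hom := by
    rw [← cup_dualTensor, ← comp_whiskerRight_assoc, ← tensorHom_id,
      tensorHom_comp_tensorHom_assoc, Category.comp_id]
  rw [l1, l2]
  simp only [MonoidalCategory.tensorHom_def]
  monoidal

theorem resh_assoc (A B C : V) :
    double (α_ A B C).hom ≫ (resh A (B ⊗ C)).hom ≫ dbl A ◁ (resh B C).hom =
      (resh (A ⊗ B) C).hom ≫ (resh A B).hom ▷ dbl C ≫ (α_ _ _ _).hom := by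
  have h1 := tensorμ_natural_left (𝟙 (dual A)) (dualTensor B C).hom A (B ⊗ C)
  have h2 := tensorμ_natural_left (dualTensor A B).hom (𝟙 (dual C)) (A ⊗ B) C
  have h3 := associator_monoidal (dual A) (dual B) (dual C) A B C
  have h4 := dualTensor_assoc A B C
  simp only [id_tensorHom, tensorHom_id, id_whiskerRight] at h1 h2
  simp only [resh, double, whiskerLeft_comp, comp_whiskerRight, Category.assoc]
  rw [← reassoc_of% h1, ← reassoc_of% h2, h3, MonoidalCategory.tensorHom_def,
    MonoidalCategory.tensorHom_def]
  simp only [Category.assoc, whisker_exchange_assoc]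
  simp only [← comp_whiskerRight_assoc, h4]

theorem cup_disc_unit : cup (𝟙_ V) ≫ disc (𝟙_ V) = 𝟙 _ := by
  have h := snake_right (𝟙_ V)
  rw [cap_eq, braiding_tensorUnit_left] at h
  calc _ = (λ_ (𝟙_ V)).inv ≫ (𝟙_ V ◁ cup (𝟙_ V) ≫ (α_ _ _ _).inv ≫
        (((λ_ _).hom ≫ (ρ_ _).inv) ≫ disc (𝟙_ V)) ▷ _) ≫ (λ_ _).hom := by monoidal
    _ = _ := by rw [h]; monoidal

theorem disc_cup_unit : disc (𝟙_ V) ≫ cup (𝟙_ V) = 𝟙 _ := by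
  have h := snake_left (𝟙_ V)
  rw [cap_eq, braiding_tensorUnit_left] at h
  calc _ = (ρ_ _).hom ≫ (λ_ _).inv ≫ (𝟙_ V ◁ ((ρ_ _).inv ≫ disc (𝟙_ V)) ≫
        cup (𝟙_ V) ▷ _) ≫ (ρ_ _).hom := by monoidal
    _ = (ρ_ _).hom ≫ (λ_ _).inv ≫ (cup (𝟙_ V) ▷ dual (𝟙_ V) ≫ (α_ _ _ _).hom ≫
        _ ◁ (((λ_ _).hom ≫ (ρ_ _).inv) ≫ disc (𝟙_ V))) := by
      rw [whisker_exchange]; monoidal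
    _ = _ := by rw [h]; monoidal

/-- The unitary isomorphism `I ≅ I* ⊗ I`. -/
def unitIso (V : Type u) [Category.{v} V] [MonoidalCategory V] [SymmetricCategory V]
    [LeftRigidCategory V] [DaggerCompactCategory V] : 𝟙_ V ≅ dbl (𝟙_ V) where
  hom := cup (𝟙_ V)
  inv := disc (𝟙_ V)
  hom_inv_id := cup_disc_unit
  inv_hom_id := disc_cup_unit

theorem conj_leftUnitor (A : V) :
    conj (λ_ A).hom = (dualTensor (𝟙_ V) A).hom ≫ ((ρ_ _).inv ≫ disc (𝟙_ V)) ▷ dual A ≫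
      (λ_ _).hom := by
  apply cup_ext
  rw [← cancel_mono (dual A ◁ (λ_ A).hom)]
  simp only [Category.assoc]
  rw [cup_conj_assoc, DaggerSymmetricCategory.dag_leftUnitor, whiskerLeft_inv_hom,
    Category.comp_id]
  have h1 := leftUnitor_monoidal (dual A) A
  have h2 := tensorμ_natural_left ((ρ_ _).inv ≫ disc (𝟙_ V)) (𝟙 (dual A)) (𝟙_ V) A
  rw [MonoidalCategory.tensorHom_def] at h1
  simp only [tensorHom_id] at h2
  simp only [comp_whiskerRight _ (λ_ _).hom, comp_whiskerRight (dualTensor _ _).hom, Category.assoc]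
  rw [h1, reassoc_of% h2, reassoc_of% (cup_dualTensor (𝟙_ V) A)]
  have e : ((ρ_ _).inv ≫ disc (𝟙_ V)) ▷ 𝟙_ V = disc (𝟙_ V) ≫ (λ_ (𝟙_ V)).inv := by monoidal
  rw [e, tensorHom_comp_tensorHom_assoc, reassoc_of% cup_disc_unit, id_whiskerRight,
    Category.comp_id, MonoidalCategory.tensorHom_def]
  monoidal

theorem resh_leftUnitor (A : V) :
    double (λ_ A).hom = (resh (𝟙_ V) A).hom ≫ disc (𝟙_ V) ▷ dbl A ≫ (λ_ _).hom := by
  have h1 := leftUnitor_monoidal (dual A) A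
  have h2 := tensorμ_natural_left ((ρ_ _).inv ≫ disc (𝟙_ V)) (𝟙 (dual A)) (𝟙_ V) A
  simp only [tensorHom_id, id_whiskerRight] at h2
  rw [MonoidalCategory.tensorHom_def] at h1
  have e : ((ρ_ _).inv ≫ disc (𝟙_ V)) ▷ 𝟙_ V = disc (𝟙_ V) ≫ (λ_ (𝟙_ V)).inv := by monoidal
  rw [double, conj_leftUnitor, MonoidalCategory.tensorHom_def]
  simp only [comp_whiskerRight _ (λ_ _).hom, comp_whiskerRight (dualTensor _ _).hom, Category.assoc]
  rw [h1, reassoc_of% h2, e, comp_whiskerRight, Category.assoc, inv_hom_whiskerRight_assoc, resh]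
  simp only [Category.assoc]

theorem conj_braiding (A B : V) :
    conj (β_ A B).hom ≫ (dualTensor B A).hom = (dualTensor A B).hom ≫ (β_ _ _).hom := by
  apply cup_ext
  rw [← cancel_mono (_ ◁ (β_ A B).hom), ← cancel_mono (tensorμ _ _ _ _)]
  have h := tensorμ_braiding (dual A) (dual B) A B
  rw [MonoidalCategory.tensorHom_def] at h
  simp only [comp_whiskerRight, Category.assoc] at h ⊢
  rw [← h, cup_conj_assoc, DaggerSymmetricCategory.dag_braiding,
    reassoc_of% (cup_dualTensor A B), ← whisker_exchange_assoc, whiskerLeft_inv_hom_assoc,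
    cup_dualTensor, BraidedCategory.braiding_naturality, braiding_tensorUnit_left]
  simp [unitors_equal]

theorem resh_braiding (A B : V) :
    double (β_ A B).hom ≫ (resh B A).hom = (resh A B).hom ≫ (β_ (dbl A) (dbl B)).hom := by
  simp only [resh, Category.assoc]
  rw [tensorμ_braiding, double, ← tensorHom_id, ← tensorHom_id, tensorHom_comp_tensorHom_assoc,
    tensorHom_comp_tensorHom_assoc, conj_braiding]
  simp

theorem resh_rightUnitor (A : V) :
    double (ρ_ A).hom = (resh A (𝟙_ V)).hom ≫ dbl A ◁ disc (𝟙_ V) ≫ (ρ_ _).hom := by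
  rw [← braiding_leftUnitor, double_comp, resh_leftUnitor, reassoc_of% (resh_braiding A (𝟙_ V)),
    ← braiding_leftUnitor (dbl A), BraidedCategory.braiding_naturality_right_assoc]

/-- The functor `A ↦ A* ⊗ A`, `f ↦ f_* ⊗ f`. -/
def doubling (V : Type u) [Category.{v} V] [MonoidalCategory V] [SymmetricCategory V]
    [LeftRigidCategory V] [DaggerCompactCategory V] : V ⥤ V where
  obj A := dbl A
  map f := double f
  map_id A := double_id A
  map_comp f g := double_comp f g

theorem double_whiskerLeft (C : V) {A B : V} (f : A ⟶ B) :
    double (C ◁ f) ≫ (resh C B).hom = (resh C A).hom ≫ dbl C ◁ double f := by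
  rw [← id_tensorHom, resh_natural, double_id, id_tensorHom]

theorem double_whiskerRight (C : V) {A B : V} (f : A ⟶ B) :
    double (f ▷ C) ≫ (resh B C).hom = (resh A C).hom ≫ double f ▷ dbl C := by
  rw [← tensorHom_id, resh_natural, double_id, tensorHom_id]

instance : (doubling V).Monoidal :=
  Functor.CoreMonoidal.toMonoidal
    { εIso := unitIso V
      μIso A B := (resh A B).symm
      μIso_hom_natural_left {A B} f C := by
        change double f ▷ dbl C ≫ (resh B C).inv = (resh A C).inv ≫ double (f ▷ C)
        rw [Iso.eq_inv_comp, ← reassoc_of% (double_whiskerRight C f), Iso.hom_inv_id,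
          Category.comp_id]
      μIso_hom_natural_right {A B} C f := by
        change dbl C ◁ double f ≫ (resh C B).inv = (resh C A).inv ≫ double (C ◁ f)
        rw [Iso.eq_inv_comp, ← reassoc_of% (double_whiskerLeft C f), Iso.hom_inv_id,
          Category.comp_id]
      associativity A B C := by
        change (resh A B).inv ▷ dbl C ≫ (resh (A ⊗ B) C).inv ≫ double (α_ A B C).hom =
          (α_ _ _ _).hom ≫ dbl A ◁ (resh B C).inv ≫ (resh A (B ⊗ C)).inv
        rw [← cancel_mono (resh A (B ⊗ C)).hom, ← cancel_mono (dbl A ◁ (resh B C).hom)]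
        simp only [Category.assoc, resh_assoc, Iso.inv_hom_id_assoc, Iso.inv_hom_id,
          Category.comp_id, whiskerLeft_inv_hom, inv_hom_whiskerRight_assoc]
      left_unitality A := by
        change (λ_ (dbl A)).hom = cup (𝟙_ V) ▷ dbl A ≫ (resh _ A).inv ≫ double (λ_ A).hom
        rw [resh_leftUnitor, Iso.inv_hom_id_assoc, ← comp_whiskerRight_assoc, cup_disc_unit]
        simp
      right_unitality A := by
        change (ρ_ (dbl A)).hom = dbl A ◁ cup (𝟙_ V) ≫ (resh A _).inv ≫ double (ρ_ A).hom
        rw [resh_rightUnitor, Iso.inv_hom_id_assoc, ← whiskerLeft_comp_assoc, cup_disc_unit]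
        simp }

instance : (doubling V).Braided where
  braided A B := by
    change (resh A B).inv ≫ double (β_ A B).hom = (β_ (dbl A) (dbl B)).hom ≫ (resh B A).inv
    rw [Iso.inv_comp_eq, ← reassoc_of% (resh_braiding A B), Iso.hom_inv_id, Category.comp_id]

theorem resh_tensorμ (A B C D : V) :
    double (tensorμ A B C D) ≫ (resh (A ⊗ C) (B ⊗ D)).hom ≫
      ((resh A C).hom ⊗ₘ (resh B D).hom) =
      (resh (A ⊗ B) (C ⊗ D)).hom ≫ ((resh A B).hom ⊗ₘ (resh C D).hom) ≫
        tensorμ (dbl A) (dbl B) (dbl C) (dbl D) := by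
  have h : tensorμ (dbl A) (dbl B) (dbl C) (dbl D) ≫ ((resh A C).inv ⊗ₘ (resh B D).inv) ≫
      (resh (A ⊗ C) (B ⊗ D)).inv = ((resh A B).inv ⊗ₘ (resh C D).inv) ≫
      (resh (A ⊗ B) (C ⊗ D)).inv ≫ double (tensorμ A B C D) :=
    tensorμ_comp_μ_tensorHom_μ_comp_μ (doubling V) A B C D
  have h' := congrArg (fun t => (resh (A ⊗ B) (C ⊗ D)).hom ≫
    ((resh A B).hom ⊗ₘ (resh C D).hom) ≫ t ≫ (resh (A ⊗ C) (B ⊗ D)).hom ≫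
      ((resh A C).hom ⊗ₘ (resh B D).hom)) h
  simpa using h'.symm

/-- The morphism `A* ⊗ A ⟶ B* ⊗ B` obtained from `g : A ⟶ X ⊗ B` by forming `g_* ⊗ g` and
connecting the two wires `X*` and `X`. -/
def kraus {A B X : V} (g : A ⟶ X ⊗ B) : dbl A ⟶ dbl B :=
  double g ≫ (resh X B).hom ≫ disc X ▷ dbl B ≫ (λ_ (dbl B)).hom

/-- The condition on `f : A* ⊗ A ⟶ B* ⊗ B` defining the morphisms of `CPM[V]`. -/
def IsCPM {A B : V} (f : dbl A ⟶ dbl B) : Prop :=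
  ∃ (X : V) (g : A ⟶ X ⊗ B), f = kraus g

theorem kraus_double {A B C X : V} (f : A ⟶ B) (g : B ⟶ X ⊗ C) :
    double f ≫ kraus g = kraus (f ≫ g) := by
  simp only [kraus, double_comp, Category.assoc]

theorem isCPM_double {A B : V} (f : A ⟶ B) : IsCPM (double f) := by
  refine ⟨𝟙_ V, f ≫ (λ_ B).inv, ?_⟩
  rw [← kraus_double, kraus, ← resh_leftUnitor, ← double_comp]
  simp

theorem IsCPM.id (A : V) : IsCPM (𝟙 (dbl A)) := by
  rw [← double_id]; exact isCPM_double _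

theorem kraus_comp_aux {X Y B C Z : V} (d : X ⟶ 𝟙_ V) (e : Y ⟶ 𝟙_ V) (h : B ⟶ Z)
    (r : Z ⟶ Y ⊗ C) :
    d ▷ B ≫ (λ_ B).hom ≫ h ≫ r ≫ e ▷ C ≫ (λ_ C).hom =
      X ◁ h ≫ X ◁ r ≫ (α_ _ _ _).inv ≫ (d ⊗ₘ e) ▷ C ≫ (λ_ (𝟙_ V)).hom ▷ C ≫ (λ_ C).hom := by
  calc _ = d ▷ B ≫ 𝟙_ V ◁ (h ≫ r ≫ e ▷ C) ⊗≫ 𝟙 _ := by monoidal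
    _ = (X ◁ (h ≫ r ≫ e ▷ C) ≫ d ▷ _) ⊗≫ 𝟙 _ := by
      rw [whisker_exchange]; monoidal
    _ = _ := by rw [MonoidalCategory.tensorHom_def']; monoidal

theorem IsCPM.comp {A B C : V} {f : dbl A ⟶ dbl B} {h : dbl B ⟶ dbl C}
    (hf : IsCPM f) (hh : IsCPM h) : IsCPM (f ≫ h) := by
  obtain ⟨X, f, rfl⟩ := hf
  obtain ⟨Y, h, rfl⟩ := hh
  refine ⟨X ⊗ Y, f ≫ X ◁ h ≫ (α_ _ _ _).inv, ?_⟩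
  have h1 : double (α_ X Y C).inv ≫ (resh (X ⊗ Y) C).hom ≫ (resh X Y).hom ▷ dbl C =
      (resh X (Y ⊗ C)).hom ≫ dbl X ◁ (resh Y C).hom ≫ (α_ _ _ _).inv := by
    rw [← cancel_mono (α_ _ _ _).hom]
    simp only [Category.assoc, ← resh_assoc]
    rw [← double_comp_assoc]
    simp
  simp only [kraus, double_comp, Category.assoc]
  rw [disc_tensor, comp_whiskerRight, Category.assoc, reassoc_of% h1,
    reassoc_of% (double_whiskerLeft X h), kraus_comp_aux]
  simp only [comp_whiskerRight, Category.assoc]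

/-- The tensor product of two morphisms of `CPM[V]`. -/
def cpmTensor {A B A' B' : V} (f : dbl A ⟶ dbl B) (f' : dbl A' ⟶ dbl B') :
    dbl (A ⊗ A') ⟶ dbl (B ⊗ B') :=
  (resh A A').hom ≫ (f ⊗ₘ f') ≫ (resh B B').inv

theorem IsCPM.tensor {A B A' B' : V} {f : dbl A ⟶ dbl B} {f' : dbl A' ⟶ dbl B'}
    (hf : IsCPM f) (hf' : IsCPM f') : IsCPM (cpmTensor f f') := by
  obtain ⟨X, g, rfl⟩ := hf
  obtain ⟨X', g', rfl⟩ := hf'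
  refine ⟨X ⊗ X', (g ⊗ₘ g') ≫ tensorμ X B X' B', ?_⟩
  rw [cpmTensor, ← Category.assoc, Iso.comp_inv_eq]
  simp only [kraus, double_comp, Category.assoc]
  have h1 : ((resh X X').hom ≫ (disc X ⊗ₘ disc X') ≫ (λ_ _).hom) ▷ dbl (B ⊗ B') ≫ (λ_ _).hom ≫
      (resh B B').hom = ((resh X X').hom ⊗ₘ (resh B B').hom) ≫
      (((disc X ⊗ₘ disc X') ≫ (λ_ _).hom) ▷ _) ≫ (λ_ _).hom := by
    rw [← leftUnitor_naturality, ← whisker_exchange_assoc,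
      MonoidalCategory.tensorHom_def' (resh X X').hom]
    simp only [comp_whiskerRight, Category.assoc]
  have h2 := tensorμ_natural_left (disc X) (disc X') (dbl B) (dbl B')
  have h3 := tensorμ_natural (disc X) (𝟙 (dbl B)) (disc X') (𝟙 (dbl B'))
  have h4 := leftUnitor_monoidal (dbl B) (dbl B')
  simp only [tensorHom_id, id_whiskerRight] at h3
  rw [disc_tensor, h1, reassoc_of% (resh_tensorμ X B X' B'), comp_whiskerRight, Category.assoc,
    ← reassoc_of% h3, ← h4, reassoc_of% (resh_natural g g')]
  simp only [tensorHom_comp_tensorHom]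

theorem conj_unitary_cup {A B : V} {u : A ⟶ B} (hu : u† ≫ u = 𝟙 B) : cup A ≫ double u = cup B := by
  rw [double, cup_conj', hu]; simp

theorem snake_braided_left {Q X : V} (b : 𝟙_ V ⟶ Q ⊗ X) (d : Q ⊗ X ⟶ 𝟙_ V)
    (h : b ▷ Q ≫ (α_ _ _ _).hom ≫ Q ◁ ((β_ X Q).hom ≫ d) = (λ_ _).hom ≫ (ρ_ _).inv) :
    (ρ_ Q).inv ≫ Q ◁ b ≫ (α_ _ _ _).inv ≫ (β_ Q Q).hom ▷ X ≫ (α_ _ _ _).hom ≫ Q ◁ d ≫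
      (ρ_ Q).hom = 𝟙 Q := by
  have e : (β_ Q Q).hom ▷ X = (α_ _ _ _).hom ≫ (β_ Q (Q ⊗ X)).hom ≫ (α_ _ _ _).hom ≫
      Q ◁ (β_ X Q).hom ≫ (α_ _ _ _).inv := by
    have s : Q ◁ (β_ Q X).hom ≫ Q ◁ (β_ X Q).hom = 𝟙 _ := by
      rw [← whiskerLeft_comp, SymmetricCategory.symmetry, whiskerLeft_id]
    rw [BraidedCategory.braiding_tensor_right_hom]
    simp [reassoc_of% s]
  rw [e]
  calc _ = (ρ_ Q).inv ≫ (Q ◁ b ≫ (β_ Q (Q ⊗ X)).hom) ≫ (α_ _ _ _).hom ≫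
      Q ◁ ((β_ X Q).hom ≫ d) ≫ (ρ_ Q).hom := by monoidal
    _ = (λ_ Q).inv ≫ (b ▷ Q ≫ (α_ _ _ _).hom ≫ Q ◁ ((β_ X Q).hom ≫ d)) ≫ (ρ_ Q).hom := by
      rw [BraidedCategory.braiding_naturality_right, braiding_tensorUnit_right]; monoidal
    _ = _ := by rw [h]; simp

theorem snake_braided_right {P Q : V} (a : 𝟙_ V ⟶ P ⊗ Q) (e : P ⊗ Q ⟶ 𝟙_ V)
    (h : Q ◁ a ≫ (α_ _ _ _).inv ≫ ((β_ Q P).hom ≫ e) ▷ Q = (ρ_ _).hom ≫ (λ_ _).inv) :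
    (λ_ Q).inv ≫ a ▷ Q ≫ (α_ _ _ _).hom ≫ P ◁ (β_ Q Q).hom ≫ (α_ _ _ _).inv ≫ e ▷ Q ≫
      (λ_ Q).hom = 𝟙 Q := by
  have e' : P ◁ (β_ Q Q).hom = (α_ _ _ _).inv ≫ (β_ (P ⊗ Q) Q).hom ≫ (α_ _ _ _).inv ≫
      (β_ Q P).hom ▷ Q ≫ (α_ _ _ _).hom := by
    have s : (β_ P Q).hom ▷ Q ≫ (β_ Q P).hom ▷ Q = 𝟙 _ := by
      rw [← comp_whiskerRight, SymmetricCategory.symmetry, id_whiskerRight]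
    rw [BraidedCategory.braiding_tensor_left_hom]
    simp [reassoc_of% s]
  rw [e']
  calc _ = (λ_ Q).inv ≫ (a ▷ Q ≫ (β_ (P ⊗ Q) Q).hom) ≫ (α_ _ _ _).inv ≫
      ((β_ Q P).hom ≫ e) ▷ Q ≫ (λ_ Q).hom := by monoidal
    _ = (ρ_ Q).inv ≫ (Q ◁ a ≫ (α_ _ _ _).inv ≫ ((β_ Q P).hom ≫ e) ▷ Q) ≫ (λ_ Q).hom := by
      rw [BraidedCategory.braiding_naturality_left, braiding_tensorUnit_left]; monoidal
    _ = _ := by rw [h]; simp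

theorem kraus_cup_aux {P Q X : V} (a : 𝟙_ V ⟶ P ⊗ Q) (b : 𝟙_ V ⟶ Q ⊗ X) (d : Q ⊗ X ⟶ 𝟙_ V)
    (e : P ⊗ Q ⟶ 𝟙_ V)
    (h : b ▷ Q ≫ (α_ _ _ _).hom ≫ Q ◁ ((β_ X Q).hom ≫ d) = (λ_ _).hom ≫ (ρ_ _).inv)
    (h' : Q ◁ a ≫ (α_ _ _ _).inv ≫ ((β_ Q P).hom ≫ e) ▷ Q = (ρ_ _).hom ≫ (λ_ _).inv) :
    (λ_ (𝟙_ V)).inv ≫ (a ⊗ₘ b) ≫ tensorδ P Q Q X ≫ (P ⊗ Q) ◁ (d ≫ b) ≫ tensorμ P Q Q X ≫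
      e ▷ (Q ⊗ X) ≫ (λ_ (Q ⊗ X)).hom = b := by
  have h1 : (λ_ (𝟙_ V)).inv ≫ (a ⊗ₘ b) ≫ tensorδ P Q Q X ≫ (P ⊗ Q) ◁ d = a ≫ (ρ_ _).inv := by
    have := snake_braided_left b d h
    calc _ = a ≫ P ◁ ((ρ_ Q).inv ≫ Q ◁ b ≫ (α_ _ _ _).inv ≫ (β_ Q Q).hom ▷ X ≫
          (α_ _ _ _).hom ≫ Q ◁ d ≫ (ρ_ Q).hom) ≫ (ρ_ _).inv := by
          rw [tensorδ_eq, tensorμ, MonoidalCategory.tensorHom_def]; monoidal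
      _ = _ := by rw [this]; simp
  have h2 : a ≫ (ρ_ _).inv ≫ (P ⊗ Q) ◁ b ≫ tensorμ P Q Q X ≫ e ▷ (Q ⊗ X) ≫
      (λ_ (Q ⊗ X)).hom = b := by
    have := snake_braided_right a e h'
    calc _ = 𝟙 _ ⊗≫ (a ▷ 𝟙_ V ≫ (P ⊗ Q) ◁ b) ⊗≫ tensorμ P Q Q X ≫ e ▷ (Q ⊗ X) ≫
          (λ_ (Q ⊗ X)).hom := by monoidal
      _ = b ≫ ((λ_ Q).inv ≫ a ▷ Q ≫ (α_ _ _ _).hom ≫ P ◁ (β_ Q Q).hom ≫ (α_ _ _ _).inv ≫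
          e ▷ Q ≫ (λ_ Q).hom) ▷ X := by
          rw [← whisker_exchange, tensorμ]; monoidal
      _ = _ := by rw [this]; simp
  rw [whiskerLeft_comp, Category.assoc, reassoc_of% h1, h2]

theorem kraus_cup (X : V) : kraus (cup X) = disc (𝟙_ V) ≫ cup X := by
  have h := kraus_cup_aux (cup (dual X)) (cup X) (disc X) (disc (dual X))
    (by rw [← cap_eq]; exact snake_left X) (by rw [← cap_eq]; exact snake_right (dual X))
  rw [← cancel_epi (unitIso V).hom]
  simp only [unitIso, reassoc_of% cup_disc_unit]
  rw [kraus, double, reassoc_of% (cup_conj' (cup X)), dag_cup]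
  refine Eq.trans ?_ h
  have h2 : cup (dual X ⊗ X) ≫ (dualTensor (dual X) X).hom ▷ (dual X ⊗ X) = (λ_ (𝟙_ V)).inv ≫
      (cup (dual X) ⊗ₘ cup X) ≫ tensorδ _ _ _ _ := by
    rw [← reassoc_of% (cup_dualTensor (dual X) X)]; simp
  rw [← reassoc_of% h2, resh]
  simp only [Category.assoc, whisker_exchange_assoc]

theorem IsCPM.dag {A B : V} {f : dbl A ⟶ dbl B} (hf : IsCPM f) : IsCPM f† := by
  obtain ⟨X, g, rfl⟩ := hf
  have h1 : IsCPM (disc (𝟙_ V) ≫ cup X) := ⟨_, _, (kraus_cup X).symm⟩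
  have h2 := ((isCPM_double (λ_ B).inv).comp (h1.tensor (IsCPM.id B))).comp (isCPM_double (g†))
  convert! h2 using 1
  simp only [kraus, DaggerCategory.dag_comp, dag_double, dag_resh, dag_whiskerRight, dag_disc,
    DaggerSymmetricCategory.dag_leftUnitor, cpmTensor, Category.assoc]
  have h3 : double (λ_ B).inv ≫ (resh (𝟙_ V) B).hom ≫ disc (𝟙_ V) ▷ dbl B = (λ_ _).inv := by
    rw [← cancel_mono (λ_ _).hom]
    simp only [Category.assoc]
    rw [← resh_leftUnitor, ← double_comp]
    simp
  rw [tensorHom_id, comp_whiskerRight, ← h3]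
  simp only [Category.assoc]

variable (V) in
/-- The category `CPM[V]`: its objects are those of `V`, and its morphisms `A ⟶ B` are the morphisms
`A* ⊗ A ⟶ B* ⊗ B` of `V` of the form `IsCPM`. -/
structure CPM where
  obj : V

namespace CPM

/-- A morphism of `CPM[V]`. -/
@[ext]
structure Hom (A B : CPM V) where
  hom : dbl A.obj ⟶ dbl B.obj
  isCPM : IsCPM hom

instance : Category (CPM V) where
  Hom := Hom
  id A := ⟨𝟙 _, IsCPM.id _⟩
  comp f g := ⟨f.hom ≫ g.hom, f.isCPM.comp g.isCPM⟩

@[ext] theorem hom_ext {A B : CPM V} {f g : A ⟶ B} (h : f.hom = g.hom) : f = g := Hom.ext h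

@[simp] theorem id_hom (A : CPM V) : Hom.hom (𝟙 A) = 𝟙 (dbl A.obj) := rfl

@[simp] theorem comp_hom {A B C : CPM V} (f : A ⟶ B) (g : B ⟶ C) :
    (f ≫ g).hom = f.hom ≫ g.hom := rfl

/-- An isomorphism of `V`, doubled. -/
def doubleIso {A B : V} (e : A ≅ B) : (⟨A⟩ : CPM V) ≅ ⟨B⟩ where
  hom := ⟨double e.hom, isCPM_double _⟩
  inv := ⟨double e.inv, isCPM_double _⟩
  hom_inv_id := by ext1; simp [← double_comp]
  inv_hom_id := by ext1; simp [← double_comp]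

instance : MonoidalCategoryStruct (CPM V) where
  tensorObj A B := ⟨A.obj ⊗ B.obj⟩
  tensorHom f g := ⟨cpmTensor f.hom g.hom, f.isCPM.tensor g.isCPM⟩
  whiskerLeft _ _ _ g := ⟨cpmTensor (𝟙 _) g.hom, (IsCPM.id _).tensor g.isCPM⟩
  whiskerRight f _ := ⟨cpmTensor f.hom (𝟙 _), f.isCPM.tensor (IsCPM.id _)⟩
  tensorUnit := ⟨𝟙_ V⟩
  associator A B C := doubleIso (α_ A.obj B.obj C.obj)
  leftUnitor A := doubleIso (λ_ A.obj)
  rightUnitor A := doubleIso (ρ_ A.obj)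

variable (V) in
/-- The functor from `CPM[V]` to `V` with `A ↦ A* ⊗ A`. -/
def forget : CPM V ⥤ V where
  obj A := dbl A.obj
  map f := f.hom

instance : (forget V).Faithful where
  map_injective h := hom_ext h

variable (V) in
/-- The monoidal structure of `CPM[V]` is transported along `forget`. -/
def inducing : Monoidal.InducingFunctorData (forget V) where
  μIso A B := (resh A.obj B.obj).symm
  whiskerLeft_eq X _ _ f := by
    change cpmTensor (𝟙 _) f.hom = (resh _ _).hom ≫ (_ ◁ f.hom) ≫ (resh _ _).inv
    rw [cpmTensor, id_tensorHom]
  whiskerRight_eq f X := by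
    change cpmTensor f.hom (𝟙 _) = (resh _ _).hom ≫ (f.hom ▷ _) ≫ (resh _ _).inv
    rw [cpmTensor, tensorHom_id]
  tensorHom_eq f g := rfl
  εIso := unitIso V
  associator_eq X Y Z := by
    change double (α_ X.obj Y.obj Z.obj).hom =
      ((resh _ _).hom ≫ ((resh X.obj Y.obj).hom ⊗ₘ 𝟙 (dbl Z.obj))) ≫ (α_ _ _ _).hom ≫
        (𝟙 (dbl X.obj) ⊗ₘ (resh _ _).inv) ≫ (resh _ _).inv
    rw [tensorHom_id, id_tensorHom, Category.assoc, ← reassoc_of% (resh_assoc X.obj Y.obj Z.obj),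
      whiskerLeft_hom_inv_assoc, Iso.hom_inv_id, Category.comp_id]
  leftUnitor_eq X := by
    change double (λ_ X.obj).hom =
      ((resh _ _).hom ≫ (disc (𝟙_ V) ⊗ₘ 𝟙 (dbl X.obj))) ≫ (λ_ _).hom
    rw [tensorHom_id, Category.assoc, resh_leftUnitor]
  rightUnitor_eq X := by
    change double (ρ_ X.obj).hom =
      ((resh _ _).hom ≫ (𝟙 (dbl X.obj) ⊗ₘ disc (𝟙_ V))) ≫ (ρ_ _).hom
    rw [id_tensorHom, Category.assoc, resh_rightUnitor]

instance : MonoidalCategory (CPM V) := Monoidal.induced (forget V) (inducing V)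

instance : (forget V).Monoidal := Monoidal.fromInducedMonoidal (forget V) (inducing V)

instance : BraidedCategory (CPM V) :=
  BraidedCategory.ofFaithful (forget V) (fun A B => doubleIso (β_ A.obj B.obj)) (fun A B => by
    change (resh A.obj B.obj).inv ≫ double (β_ A.obj B.obj).hom =
      (β_ (dbl A.obj) (dbl B.obj)).hom ≫ (resh B.obj A.obj).inv
    rw [Iso.inv_comp_eq, ← reassoc_of% (resh_braiding A.obj B.obj), Iso.hom_inv_id,
      Category.comp_id])

instance : SymmetricCategory (CPM V) where
  symmetry A B := by
    ext1
    change double (β_ A.obj B.obj).hom ≫ double (β_ B.obj A.obj).hom = 𝟙 _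
    rw [← double_comp, SymmetricCategory.symmetry, double_id]

instance : DaggerSymmetricCategory (CPM V) where
  dag f := ⟨f.hom†, f.isCPM.dag⟩
  dag_id A := by ext1; simp
  dag_comp f g := by ext1; simp
  dag_dag f := by ext1; simp
  dag_tensor f g := by
    ext1
    change (cpmTensor f.hom g.hom)† = cpmTensor (f.hom†) (g.hom†)
    simp [cpmTensor, dag_resh, dag_resh_inv]
  dag_associator A B C := by
    ext1
    change (double (α_ A.obj B.obj C.obj).hom)† = double (α_ A.obj B.obj C.obj).inv
    simp
  dag_leftUnitor A := by
    ext1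
    change (double (λ_ A.obj).hom)† = double (λ_ A.obj).inv
    simp
  dag_rightUnitor A := by
    ext1
    change (double (ρ_ A.obj).hom)† = double (ρ_ A.obj).inv
    simp
  dag_braiding A B := by
    ext1
    change (double (β_ A.obj B.obj).hom)† = double (β_ A.obj B.obj).inv
    simp

end CPM

open scoped MonObj

/-- The coaction `A ⟶ A* ⊗ A` of an algebra on itself: the transpose of its multiplication. -/
def coact (A : V) [MonObj A] : A ⟶ dbl A :=
  (λ_ A).inv ≫ cup A ▷ A ≫ (α_ _ _ _).hom ≫ dual A ◁ μ[A]

/-- The action `A* ⊗ A ⟶ A`, the dagger of the coaction. -/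
def act (A : V) [MonObj A] : dbl A ⟶ A := (coact A)†

/-- The loop `A ⟶ I`: the partial trace of the multiplication. -/
def loop (A : V) [MonObj A] : A ⟶ 𝟙_ V := coact A ≫ disc A

/-- An algebra (monoid object) is a dagger Frobenius algebra if it satisfies the Frobenius law
`(1 ⊗ m) ∘ (m† ⊗ 1) = (m ⊗ 1) ∘ (1 ⊗ m†)`. -/
class DaggerFrobenius (A : V) [MonObj A] : Prop where
  frobenius : (μ[A])† ▷ A ≫ (α_ A A A).hom ≫ A ◁ μ[A] =
    A ◁ (μ[A])† ≫ (α_ A A A).inv ≫ μ[A] ▷ A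

/-- A morphism `A ⟶ A` is positive if it is of the form `h† ∘ h`. -/
def IsPositive {A : V} (f : A ⟶ A) : Prop := ∃ (X : V) (h : A ⟶ X), f = h ≫ h†

/-- A map `A ⟶ A` is central for an algebra if it commutes with left and right multiplication. -/
def IsCentral (A : V) [MonObj A] (z : A ⟶ A) : Prop :=
  z ▷ A ≫ μ[A] = μ[A] ≫ z ∧ A ◁ z ≫ μ[A] = μ[A] ≫ z

/-- A dagger Frobenius algebra is normalisable if there is a central positive definite `z : A ⟶ A`
such that the loop composed with `z ∘ z` is the counit. -/
def IsNormalisable (A : V) [MonObj A] : Prop :=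
  ∃ z : A ⟶ A, IsPositive z ∧ IsIso z ∧ IsCentral A z ∧ z ≫ z ≫ loop A = (η[A])†

/-- The condition on `f : A ⟶ B` defining the morphisms of `CP*[V]`: the morphism
`A* ⊗ A ⟶ B* ⊗ B` obtained from the action of `A`, then `f`, then the coaction of `B` is of the
form of the morphisms of `CPM[V]`. -/
def IsCPStar {A B : V} [MonObj A] [MonObj B] (f : A ⟶ B) : Prop :=
  IsCPM (act A ≫ f ≫ coact B)

theorem dag_act (A : V) [MonObj A] : (act A)† = coact A := DaggerCategory.dag_dag _

theorem dag_coact (A : V) [MonObj A] : (coact A)† = act A := rfl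

theorem act_eq (A : V) [MonObj A] :
    act A = dual A ◁ (μ[A])† ≫ (α_ _ _ _).inv ≫ disc A ▷ A ≫ (λ_ A).hom := by
  simp [act, coact, dag_cup]

theorem IsPositive.dag {A : V} {f : A ⟶ A} (h : IsPositive f) : f† = f := by
  obtain ⟨X, h, rfl⟩ := h
  simp

theorem comul_eq (A : V) [MonObj A] [DaggerFrobenius A] :
    (μ[A])† = (λ_ A).inv ≫ (η[A] ≫ (μ[A])†) ▷ A ≫ (α_ A A A).hom ≫ A ◁ μ[A] := by
  have F := DaggerFrobenius.frobenius (A := A)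
  rw [comp_whiskerRight, Category.assoc, F]
  calc _ = (λ_ A).inv ≫ 𝟙_ V ◁ (μ[A])† ⊗≫ (η[A] ▷ A ≫ μ[A]) ▷ A := by
        rw [MonObj.one_mul]; monoidal
    _ = (λ_ A).inv ≫ (𝟙_ V ◁ (μ[A])† ≫ η[A] ▷ (A ⊗ A)) ⊗≫ μ[A] ▷ A := by monoidal
    _ = _ := by rw [whisker_exchange]; monoidal

theorem frobenius_mul (A : V) [MonObj A] [DaggerFrobenius A] :
    (μ[A])† ▷ A ≫ (α_ A A A).hom ≫ A ◁ μ[A] = μ[A] ≫ (μ[A])† := by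
  have h := comul_eq A
  set d := η[A] ≫ (μ[A])†
  calc _ = ((λ_ A).inv ≫ d ▷ A ≫ (α_ A A A).hom ≫ A ◁ μ[A]) ▷ A ≫ (α_ A A A).hom ≫
        A ◁ μ[A] := by rw [← h]
    _ = 𝟙 _ ⊗≫ d ▷ (A ⊗ A) ⊗≫ A ◁ (μ[A] ▷ A ≫ μ[A]) := by monoidal
    _ = 𝟙 _ ⊗≫ (d ▷ (A ⊗ A) ≫ (A ⊗ A) ◁ μ[A]) ⊗≫ A ◁ μ[A] := by
        rw [MonObj.mul_assoc]; monoidal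
    _ = μ[A] ≫ ((λ_ A).inv ≫ d ▷ A ≫ (α_ A A A).hom ≫ A ◁ μ[A]) := by
        rw [← whisker_exchange]; monoidal
    _ = _ := by rw [← h]

theorem frobenius_mul' (A : V) [MonObj A] [DaggerFrobenius A] :
    A ◁ (μ[A])† ≫ (α_ A A A).inv ≫ μ[A] ▷ A = μ[A] ≫ (μ[A])† := by
  rw [← DaggerFrobenius.frobenius, frobenius_mul]

theorem coact_act (A : V) [MonObj A] [DaggerFrobenius A] :
    coact A ≫ act A = (λ_ A).inv ≫ (cup A ≫ act A) ▷ A ≫ μ[A] := by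
  rw [act_eq, coact]
  calc _ = (λ_ A).inv ≫ cup A ▷ A ≫ (α_ _ _ _).hom ≫ dual A ◁ (μ[A] ≫ (μ[A])†) ≫
        (α_ _ _ _).inv ≫ disc A ▷ A ≫ (λ_ A).hom := by simp
    _ = (λ_ A).inv ≫ cup A ▷ A ≫ 𝟙 _ ⊗≫ (dual A ◁ (μ[A])†) ▷ A ⊗≫
        ((dual A ⊗ A) ◁ μ[A] ≫ disc A ▷ A) ⊗≫ 𝟙 _ := by
        rw [← frobenius_mul]; monoidal
    _ = _ := by rw [whisker_exchange]; monoidal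

theorem coact_double {A : V} [MonObj A] {z : A ⟶ A} (hz : z† = z) (hc : IsCentral A z) :
    coact A ≫ double z = coact A ≫ dual A ◁ (z ≫ z) := by
  rw [coact, double, MonoidalCategory.tensorHom_def, whiskerLeft_comp]
  simp only [Category.assoc, whisker_exchange_assoc]
  have h : cup A ≫ conj z ▷ A = cup A ≫ dual A ◁ z := by rw [cup_conj, hz]
  calc _ = (λ_ A).inv ≫ (cup A ≫ conj z ▷ A) ▷ A ≫ (α_ _ _ _).hom ≫ dual A ◁ μ[A] ≫
        dual A ◁ z := by monoidal
    _ = (λ_ A).inv ≫ cup A ▷ A ≫ (α_ _ _ _).hom ≫ dual A ◁ (z ▷ A ≫ μ[A]) ≫ dual A ◁ z := by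
        rw [h]; monoidal
    _ = _ := by rw [hc.1]; simp

theorem whiskerLeft_act {A : V} [MonObj A] {z : A ⟶ A} (hz : z† = z) (hc : IsCentral A z) :
    dual A ◁ z ≫ act A = act A ≫ z := by
  have h : z ≫ (μ[A])† = (μ[A])† ≫ A ◁ z := by
    apply dag_inj
    simpa [hz] using hc.2.symm
  rw [act_eq]
  calc _ = dual A ◁ (z ≫ (μ[A])†) ≫ (α_ _ _ _).inv ≫ disc A ▷ A ≫ (λ_ A).hom := by simp
    _ = dual A ◁ (μ[A])† ≫ (α_ _ _ _).inv ≫ ((dual A ⊗ A) ◁ z ≫ disc A ▷ A) ≫ (λ_ A).hom := by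
        rw [h]; simp
    _ = _ := by rw [whisker_exchange]; monoidal

theorem coact_double_act {A : V} [MonObj A] [DaggerFrobenius A] {z : A ⟶ A} (hz : z† = z)
    (hc : IsCentral A z) (hn : z ≫ z ≫ loop A = (η[A])†) :
    coact A ≫ double z ≫ act A = 𝟙 A := by
  have h : cup A ≫ act A ≫ z ≫ z = η[A] := by
    apply dag_inj
    rw [← hn]
    simp [loop, dag_cup, dag_act, hz]
  rw [← Category.assoc, coact_double hz hc, whiskerLeft_comp]
  simp only [Category.assoc]
  rw [whiskerLeft_act hz hc, reassoc_of% (whiskerLeft_act hz hc), reassoc_of% (coact_act A),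
    ← reassoc_of% hc.1, ← hc.1, ← comp_whiskerRight_assoc, ← comp_whiskerRight_assoc]
  simp only [Category.assoc]
  rw [h]
  simp

theorem IsCPStar.comp {A B C : V} [MonObj A] [MonObj B] [MonObj C] [DaggerFrobenius B]
    (hB : IsNormalisable B) {f : A ⟶ B} {g : B ⟶ C} (hf : IsCPStar f) (hg : IsCPStar g) :
    IsCPStar (f ≫ g) := by
  obtain ⟨z, hp, -, hc, hn⟩ := hB
  have h := coact_double_act hp.dag hc hn
  have h2 := IsCPM.comp (IsCPM.comp hf (isCPM_double z)) hg
  simp only [Category.assoc, reassoc_of% h] at h2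
  simpa [IsCPStar] using h2

theorem IsCPStar.dag {A B : V} [MonObj A] [MonObj B] {f : A ⟶ B} (hf : IsCPStar f) :
    IsCPStar f† := by
  have h := IsCPM.dag hf
  simpa [IsCPStar, dag_act, dag_coact] using h

theorem cyc_hexagon (X Y Z : V) :
    (β_ X (Y ⊗ Z)).hom ≫ (α_ Y Z X).hom ≫ (β_ Y (Z ⊗ X)).hom =
      (α_ _ _ _).inv ≫ (β_ (X ⊗ Y) Z).hom ≫ (α_ _ _ _).inv := by
  have s : (β_ Z X).hom ▷ Y ≫ (β_ X Z).hom ▷ Y = 𝟙 _ := by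
    rw [← comp_whiskerRight, SymmetricCategory.symmetry, id_whiskerRight]
  rw [← cancel_epi (β_ (Y ⊗ Z) X).hom, SymmetricCategory.symmetry_assoc]
  have h1 : (β_ Y (Z ⊗ X)).hom = (α_ _ _ _).inv ≫ (β_ Y Z).hom ▷ X ≫ (α_ _ _ _).hom ≫
      Z ◁ (β_ Y X).hom ≫ (α_ _ _ _).inv := by
    rw [BraidedCategory.braiding_tensor_right_hom]
  have h2 : (β_ (X ⊗ Y) Z).hom = (α_ _ _ _).hom ≫ X ◁ (β_ Y Z).hom ≫ (α_ _ _ _).inv ≫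
      (β_ X Z).hom ▷ Y ≫ (α_ _ _ _).hom := by
    rw [BraidedCategory.braiding_tensor_left_hom]
  have h3 : (β_ (Z ⊗ Y) X).hom = (α_ _ _ _).hom ≫ Z ◁ (β_ Y X).hom ≫ (α_ _ _ _).inv ≫
      (β_ Z X).hom ▷ Y ≫ (α_ _ _ _).hom := by
    rw [BraidedCategory.braiding_tensor_left_hom]
  rw [h2]
  simp only [Iso.inv_hom_id_assoc, Category.assoc]
  rw [← BraidedCategory.braiding_naturality_left_assoc, h3, h1]
  simp [s]

/-- The closed loop through two boxes. -/
def pairing (A B : V) : (dual A ⊗ B) ⊗ (dual B ⊗ A) ⟶ 𝟙_ V :=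
  𝟙 _ ⊗≫ dual A ◁ (cap B ▷ A) ⊗≫ disc A

theorem pairing_symm (A B : V) :
    (β_ (dual A ⊗ B) (dual B ⊗ A)).hom ≫ pairing B A = pairing A B := by
  have hc : ∀ A : V, disc A = (β_ (dual A) A).hom ≫ cap A := fun A => by
    rw [cap_eq, SymmetricCategory.symmetry_assoc]
  have h1 : pairing B A = (α_ _ _ _).hom ≫ dual B ◁ ((α_ _ _ _).inv ≫ cap A ▷ B ≫ (λ_ _).hom) ≫
      disc B := by
    rw [pairing]; monoidal
  have h2 : pairing A B = (α_ _ _ _).inv ≫ ((α_ _ _ _).hom ≫ dual A ◁ cap B ≫ (ρ_ _).hom) ▷ A ≫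
      disc A := by
    rw [pairing]; monoidal
  rw [h1, h2, hc A, hc B, BraidedCategory.braiding_naturality_right_assoc,
    BraidedCategory.braiding_naturality_left_assoc, reassoc_of% (cyc_hexagon (dual A ⊗ B) (dual B) A)]
  calc _ = (α_ (dual A ⊗ B) (dual B) A).inv ≫ (β_ ((dual A ⊗ B) ⊗ dual B) A).hom ≫ 𝟙 _ ⊗≫
      (cap A ▷ (B ⊗ dual B) ≫ 𝟙_ V ◁ cap B) ⊗≫ 𝟙 _ := by monoidal
    _ = _ := by rw [← whisker_exchange]; monoidal

theorem mul_loop (A : V) [MonObj A] : μ[A] ≫ loop A = (coact A ⊗ₘ coact A) ≫ pairing A A := by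
  have h : μ[A] ≫ coact A = coact A ▷ A ≫ (α_ _ _ _).hom ≫ dual A ◁ μ[A] := by
    rw [coact]
    calc _ = 𝟙 _ ⊗≫ (𝟙_ V ◁ μ[A] ≫ cup A ▷ A) ⊗≫ dual A ◁ μ[A] := by monoidal
      _ = 𝟙 _ ⊗≫ cup A ▷ (A ⊗ A) ⊗≫ dual A ◁ ((α_ _ _ _).inv ≫ μ[A] ▷ A ≫ μ[A]) := by
        rw [whisker_exchange, ← MonObj.mul_assoc_flip]; monoidal
      _ = _ := by monoidal
  have h2 : A ◁ coact A ≫ 𝟙 _ ⊗≫ (cap A ▷ A) ⊗≫ 𝟙 _ = μ[A] := by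
    rw [coact]
    calc _ = 𝟙 _ ⊗≫ (A ◁ cup A ≫ (α_ _ _ _).inv ≫ cap A ▷ A) ▷ A ≫
          (λ_ A).hom ▷ A ≫ μ[A] := by
          refine Eq.trans (b := 𝟙 _ ⊗≫ A ◁ (cup A ▷ A) ⊗≫
            ((A ⊗ dual A) ◁ μ[A] ≫ cap A ▷ A) ⊗≫ 𝟙 _) (by monoidal) ?_
          rw [whisker_exchange]
          monoidal
      _ = _ := by rw [snake_right]; monoidal
  rw [loop, reassoc_of% h, MonoidalCategory.tensorHom_def, pairing, ← h2]
  monoidal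

theorem mul_loop_symm (A : V) [MonObj A] : (β_ A A).hom ≫ μ[A] ≫ loop A = μ[A] ≫ loop A := by
  rw [mul_loop, ← BraidedCategory.braiding_naturality_assoc, pairing_symm]

theorem IsNormalisable.symmetric {A : V} [MonObj A] (h : IsNormalisable A) :
    (β_ A A).hom ≫ μ[A] ≫ (η[A])† = μ[A] ≫ (η[A])† := by
  obtain ⟨z, -, -, hc, hn⟩ := h
  have h1 : ∀ {Z : V} (k : A ⟶ Z), A ◁ z ≫ A ◁ z ≫ μ[A] ≫ k = μ[A] ≫ z ≫ z ≫ k := fun k => by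
    rw [reassoc_of% hc.2, reassoc_of% hc.2]
  have h2 : ∀ {Z : V} (k : A ⟶ Z), z ▷ A ≫ z ▷ A ≫ μ[A] ≫ k = μ[A] ≫ z ≫ z ≫ k := fun k => by
    rw [reassoc_of% hc.1, reassoc_of% hc.1]
  rw [← hn, ← h2, ← BraidedCategory.braiding_naturality_right_assoc,
    ← BraidedCategory.braiding_naturality_right_assoc, mul_loop_symm, h1, h2]

theorem comul_eq' (A : V) [MonObj A] [DaggerFrobenius A] :
    (μ[A])† = (ρ_ A).inv ≫ A ◁ (η[A] ≫ (μ[A])†) ≫ (α_ A A A).inv ≫ μ[A] ▷ A := by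
  have F := DaggerFrobenius.frobenius (A := A)
  rw [whiskerLeft_comp, Category.assoc, ← F]
  calc _ = (ρ_ A).inv ≫ (μ[A])† ▷ 𝟙_ V ⊗≫ A ◁ (A ◁ η[A] ≫ μ[A]) := by
        rw [MonObj.mul_one]; monoidal
    _ = (ρ_ A).inv ≫ ((μ[A])† ▷ 𝟙_ V ≫ (A ⊗ A) ◁ η[A]) ⊗≫ A ◁ μ[A] := by monoidal
    _ = _ := by rw [← whisker_exchange]; monoidal

theorem frobenius_swap_aux (A : V) [MonObj A] [DaggerFrobenius A] (hA : IsNormalisable A) :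
    A ◁ (η[A] ≫ (μ[A])†) ≫ (α_ _ _ _).inv ≫ (β_ A A).hom ▷ A ≫ (α_ _ _ _).hom ≫ A ◁ μ[A] =
      A ◁ (η[A] ≫ (μ[A])†) ≫ (α_ _ _ _).inv ≫ (β_ A A).hom ▷ A ≫ μ[A] ▷ A := by
  have s := congrArg DaggerCategory.dag hA.symmetric
  simp only [DaggerCategory.dag_comp, DaggerCategory.dag_dag, Category.assoc,
    DaggerSymmetricCategory.dag_braiding, ← SymmetricCategory.braiding_swap_eq_inv_braiding] at s
  have c := comul_eq A
  have c' := comul_eq' A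
  rw [← cancel_epi (ρ_ A).inv, ← s]
  have h1 : A ◁ (β_ A A).hom ≫ (α_ _ _ _).inv ≫ (β_ A A).hom ▷ A ≫ (α_ _ _ _).hom ≫ A ◁ μ[A] =
      (α_ _ _ _).inv ≫ μ[A] ▷ A ≫ (β_ A A).hom := by
    rw [BraidedCategory.braiding_naturality_left, BraidedCategory.braiding_tensor_left_hom]
    simp
  have h2 : A ◁ (β_ A A).hom ≫ (α_ _ _ _).inv ≫ (β_ A A).hom ▷ A ≫ μ[A] ▷ A =
      (β_ A (A ⊗ A)).hom ≫ (α_ _ _ _).hom ≫ A ◁ μ[A] ≫ (β_ A A).hom := by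
    rw [BraidedCategory.braiding_naturality_right, reassoc_of% (cyc_hexagon A A A),
      BraidedCategory.braiding_tensor_left_hom]
    simp
  have e1 : ∀ d : 𝟙_ V ⟶ A ⊗ A, A ◁ (d ≫ (β_ A A).hom) ≫ (α_ _ _ _).inv ≫ (β_ A A).hom ▷ A ≫
      (α_ _ _ _).hom ≫ A ◁ μ[A] = A ◁ d ≫ (α_ _ _ _).inv ≫ μ[A] ▷ A ≫ (β_ A A).hom := fun d => by
    rw [whiskerLeft_comp, Category.assoc, h1]
  have e2 : ∀ d : 𝟙_ V ⟶ A ⊗ A, A ◁ (d ≫ (β_ A A).hom) ≫ (α_ _ _ _).inv ≫ (β_ A A).hom ▷ A ≫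
      μ[A] ▷ A = (ρ_ A).hom ≫ (λ_ A).inv ≫ d ▷ A ≫ (α_ _ _ _).hom ≫ A ◁ μ[A] ≫ (β_ A A).hom :=
    fun d => by
      rw [whiskerLeft_comp, Category.assoc, h2, BraidedCategory.braiding_naturality_right_assoc,
        braiding_tensorUnit_right]
      simp
  have e1' := e1 (η[A] ≫ (μ[A])†)
  have e2' := e2 (η[A] ≫ (μ[A])†)
  simp only [Category.assoc] at e1' e2' c c' ⊢
  rw [e1', e2', Iso.inv_hom_id_assoc, ← reassoc_of% c, ← reassoc_of% c']

theorem frobenius_swap (A : V) [MonObj A] [DaggerFrobenius A] (hA : IsNormalisable A) :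
    A ◁ (μ[A])† ≫ (α_ _ _ _).inv ≫ (β_ A A).hom ▷ A ≫ (α_ _ _ _).hom ≫ A ◁ μ[A] =
      A ◁ (μ[A])† ≫ (α_ _ _ _).inv ≫ (β_ A A).hom ▷ A ≫ μ[A] ▷ A := by
  have h := frobenius_swap_aux A hA
  have c := comul_eq A
  set d := η[A] ≫ (μ[A])†
  rw [c]
  calc _ = 𝟙 _ ⊗≫ (A ◁ d ≫ (α_ _ _ _).inv ≫ (β_ A A).hom ▷ A) ▷ A ⊗≫
        (A ⊗ A) ◁ μ[A] ⊗≫ A ◁ μ[A] := by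
          refine Eq.trans (b := 𝟙 _ ⊗≫ (A ◁ d) ▷ A ⊗≫ ((A ⊗ A) ◁ μ[A] ≫ (β_ A A).hom ▷ A) ⊗≫
            A ◁ μ[A]) (by monoidal) ?_
          rw [whisker_exchange]; monoidal
    _ = 𝟙 _ ⊗≫ (A ◁ d ≫ (α_ _ _ _).inv ≫ (β_ A A).hom ▷ A ≫ (α_ _ _ _).hom ≫ A ◁ μ[A]) ▷ A ⊗≫
        A ◁ μ[A] := by
          refine Eq.trans (b := 𝟙 _ ⊗≫ (A ◁ d ≫ (α_ _ _ _).inv ≫ (β_ A A).hom ▷ A) ▷ A ⊗≫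
            A ◁ (A ◁ μ[A] ≫ μ[A])) (by monoidal) ?_
          rw [MonObj.mul_assoc_flip]; monoidal
    _ = 𝟙 _ ⊗≫ (A ◁ d ≫ (α_ _ _ _).inv ≫ (β_ A A).hom ▷ A) ▷ A ⊗≫
        (μ[A] ▷ (A ⊗ A) ≫ A ◁ μ[A]) := by
          rw [h]; monoidal
    _ = 𝟙 _ ⊗≫ (A ◁ d) ▷ A ⊗≫ ((A ⊗ A) ◁ μ[A] ≫ (β_ A A).hom ▷ A) ⊗≫ μ[A] ▷ A := by
          rw [← whisker_exchange, whisker_exchange (β_ A A).hom]; monoidal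
    _ = _ := by monoidal

theorem snake_left' (A : V) :
    dual A ◁ (cap A)† ≫ (α_ _ _ _).inv ≫ disc A ▷ dual A = (ρ_ _).hom ≫ (λ_ _).inv := by
  have h := congrArg DaggerCategory.dag (snake_left A)
  simpa [dag_cup] using h

theorem snake_right' (A : V) :
    (cap A)† ▷ A ≫ (α_ _ _ _).hom ≫ A ◁ disc A = (λ_ _).hom ≫ (ρ_ _).inv := by
  have h := congrArg DaggerCategory.dag (snake_right A)
  simpa [dag_cup] using h

/-- The transpose of a morphism out of `A* ⊗ A`. -/
def bend {A Z : V} (k : dbl A ⟶ Z) : A ⟶ A ⊗ Z :=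
  (λ_ A).inv ≫ (cap A)† ▷ A ≫ (α_ _ _ _).hom ≫ A ◁ k

theorem bend_inj {A Z : V} {k k' : dbl A ⟶ Z} (h : bend k = bend k') : k = k' := by
  have r : ∀ k : dbl A ⟶ Z, k = dual A ◁ bend k ≫ (α_ _ _ _).inv ≫ disc A ▷ Z ≫ (λ_ Z).hom := by
    intro k
    symm
    rw [bend]
    calc _ = 𝟙 _ ⊗≫ dual A ◁ (cap A)† ▷ A ⊗≫ ((dual A ⊗ A) ◁ k ≫ disc A ▷ Z) ⊗≫ 𝟙 _ := by monoidal
      _ = 𝟙 _ ⊗≫ (dual A ◁ (cap A)† ≫ (α_ _ _ _).inv ≫ disc A ▷ dual A) ▷ A ⊗≫ k := by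
        rw [whisker_exchange]; monoidal
      _ = _ := by rw [snake_left']; monoidal
  rw [r k, r k', h]

theorem bend_act (A : V) [MonObj A] {Z : V} (k : A ⟶ Z) : bend (act A ≫ k) = (μ[A])† ≫ A ◁ k := by
  rw [bend, act_eq]
  calc _ = 𝟙 _ ⊗≫ ((cap A)† ▷ A ≫ (A ⊗ dual A) ◁ (μ[A])†) ⊗≫ A ◁ (disc A ▷ A) ⊗≫ A ◁ k := by
        monoidal
    _ = 𝟙 _ ⊗≫ (𝟙_ V ◁ (μ[A])†) ⊗≫ ((cap A)† ▷ A ≫ (α_ _ _ _).hom ≫ A ◁ disc A) ▷ A ⊗≫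
        A ◁ k := by rw [← whisker_exchange]; monoidal
    _ = _ := by rw [snake_right']; monoidal

theorem dag_cap_dualTensor (A B : V) :
    (cap (A ⊗ B))† ≫ (A ⊗ B) ◁ (dualTensor A B).hom =
      (λ_ _).inv ≫ ((cap A)† ⊗ₘ (cap B)†) ≫ tensorδ A B (dual A) (dual B) := by
  rw [← cap_dualTensor]
  simp [dag_tensorμ, dag_dualTensor]

theorem tensorμ_tensorμ (A B C D : V) : tensorμ A B C D ≫ tensorμ A C B D = 𝟙 _ := by
  rw [← tensorδ_eq A C B D, tensorδ_tensorμ]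

theorem bend_kraus_aux {X Xs B Bs : V} (c : 𝟙_ V ⟶ X ⊗ Xs) (e : 𝟙_ V ⟶ B ⊗ Bs)
    (d : Xs ⊗ X ⟶ 𝟙_ V)
    (h : c ▷ X ≫ (α_ _ _ _).hom ≫ X ◁ d = (λ_ _).hom ≫ (ρ_ _).inv) :
    ((λ_ (𝟙_ V)).inv ≫ (c ⊗ₘ e) ≫ tensorδ X B Xs Bs) ▷ (X ⊗ B) ≫ (α_ _ _ _).hom ≫
      (X ⊗ B) ◁ (tensorμ Xs Bs X B ≫ d ▷ (Bs ⊗ B) ≫ (λ_ _).hom) =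
    (λ_ _).hom ≫ X ◁ ((λ_ B).inv ≫ e ▷ B ≫ (α_ _ _ _).hom) ≫ (α_ _ _ _).inv := by
  have h1 : tensorμ X Xs B Bs ▷ (X ⊗ B) ≫ (α_ _ _ _).hom ≫ (X ⊗ B) ◁ tensorμ Xs Bs X B =
      tensorμ (X ⊗ Xs) (B ⊗ Bs) X B ≫ ((α_ X Xs X).hom ⊗ₘ (α_ B Bs B).hom) ≫
        tensorμ X (Xs ⊗ X) B (Bs ⊗ B) := by
    have t := associator_monoidal X Xs X B Bs B
    rw [← cancel_epi (tensorμ (X ⊗ Xs) X (B ⊗ Bs) B), reassoc_of% t,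
      reassoc_of% (tensorμ_tensorμ (X ⊗ Xs) X (B ⊗ Bs) B), ← whiskerLeft_comp, tensorμ_tensorμ,
      whiskerLeft_id, Category.comp_id]
  have h2 := tensorμ_natural_left c e X B
  have h3 := tensorμ_natural (𝟙 X) d (𝟙 B) (𝟙 (Bs ⊗ B))
  simp only [id_tensorHom, tensorHom_id, id_whiskerRight] at h3
  have h4 := leftUnitor_monoidal X B
  have h5 : tensorμ X (𝟙_ V) B (Bs ⊗ B) ≫ (X ⊗ B) ◁ (λ_ _).hom =
      (ρ_ X).hom ▷ _ ≫ (α_ _ _ _).inv := by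
    rw [tensorμ, braiding_tensorUnit_left]; monoidal
  simp only [comp_whiskerRight, whiskerLeft_comp, Category.assoc, tensorδ_eq]
  rw [reassoc_of% h1, reassoc_of% h2, ← reassoc_of% h3, h5, tensorHom_comp_tensorHom_assoc,
    ← tensorHom_id (X ◁ d), ← tensorHom_id (ρ_ X).hom, tensorHom_comp_tensorHom_assoc,
    tensorHom_comp_tensorHom_assoc]
  simp only [Category.assoc, Category.comp_id]
  rw [reassoc_of% h, Iso.inv_hom_id, Category.comp_id]
  have h6 : ((λ_ X).hom ⊗ₘ e ▷ B ≫ (α_ _ _ _).hom) = ((λ_ X).hom ⊗ₘ (λ_ B).hom) ≫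
      X ◁ ((λ_ B).inv ≫ e ▷ B ≫ (α_ _ _ _).hom) := by
    rw [← id_tensorHom, tensorHom_comp_tensorHom]; simp
  rw [h6, h4, Category.assoc, Category.assoc, reassoc_of% (tensorμ_tensorμ (𝟙_ V) (𝟙_ V) X B)]
  simp

theorem bend_kraus {A B X : V} (g : A ⟶ X ⊗ B) :
    bend (kraus g) = g ≫ X ◁ ((λ_ B).inv ≫ (cap B)† ▷ B ≫ (α_ _ _ _).hom) ≫
      (α_ _ _ _).inv ≫ g† ▷ dbl B := by
  have hg : (cap A)† ≫ A ◁ conj g = (cap (X ⊗ B))† ≫ g† ▷ _ := by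
    have := congrArg DaggerCategory.dag (conj_cap (g†))
    simpa using this
  have h := bend_kraus_aux (cap X)† (cap B)† (disc X) (snake_right' X)
  rw [← dag_cap_dualTensor] at h
  set W := resh X B with hW
  have h' : (cap (X ⊗ B))† ▷ (X ⊗ B) ≫ (α_ _ _ _).hom ≫
      (X ⊗ B) ◁ ((resh X B).hom ≫ disc X ▷ dbl B ≫ (λ_ _).hom) =
      (λ_ _).hom ≫ X ◁ ((λ_ B).inv ≫ (cap B)† ▷ B ≫ (α_ _ _ _).hom) ≫ (α_ _ _ _).inv := by
    rw [← h, resh]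
    simp only [whiskerLeft_comp, comp_whiskerRight, Category.assoc, whisker_assoc,
      Iso.inv_hom_id_assoc]
  have h'' := (Iso.eq_inv_comp _).2 h'.symm
  rw [reassoc_of% h'', bend, kraus, double, MonoidalCategory.tensorHom_def]
  calc _ = (λ_ A).inv ≫ ((cap A)† ≫ A ◁ conj g) ▷ A ≫ (α_ _ _ _).hom ≫ A ◁ (dual (X ⊗ B) ◁ g ≫
        (resh X B).hom ≫ disc X ▷ dbl B ≫ (λ_ _).hom) := by monoidal
    _ = 𝟙 _ ⊗≫ ((cap (X ⊗ B))† ▷ A ⊗≫ (g† ▷ (dual (X ⊗ B) ⊗ A) ≫ A ◁ (dual (X ⊗ B) ◁ g ≫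
        (resh X B).hom ≫ disc X ▷ dbl B ≫ (λ_ _).hom))) := by
      rw [hg]; monoidal
    _ = 𝟙 _ ⊗≫ (((cap (X ⊗ B))† ▷ A ≫ (_ ◁ g)) ⊗≫ (X ⊗ B) ◁ (
        (resh X B).hom ≫ disc X ▷ dbl B ≫ (λ_ _).hom)) ≫ g† ▷ dbl B := by
      rw [← whisker_exchange]; monoidal
    _ = _ := by
      rw [← whisker_exchange]; monoidal

theorem act_coact_aux (A : V) [MonObj A] [DaggerFrobenius A] (hA : IsNormalisable A) :
    (μ[A])† ≫ A ◁ coact A = (μ[A])† ≫ A ◁ ((λ_ A).inv ≫ (cap A)† ▷ A ≫ (α_ _ _ _).hom) ≫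
      (α_ _ _ _).inv ≫ μ[A] ▷ dbl A := by
  have h := frobenius_swap A hA
  have k := congrArg (fun t => (λ_ A).inv ≫ cup A ▷ A ≫ (α_ _ _ _).hom ≫ dual A ◁ t ≫
    (α_ _ _ _).inv ≫ (β_ (dual A) A).hom ▷ A ≫ (α_ _ _ _).hom) h
  refine Eq.trans (Eq.trans ?_ k) ?_
  · have e : dual A ◁ (β_ A A).hom ≫ (α_ _ _ _).inv ≫ (β_ (dual A) A).hom ▷ A =
        (α_ _ _ _).inv ≫ (β_ (dual A ⊗ A) A).hom ≫ (α_ _ _ _).inv := by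
      rw [BraidedCategory.braiding_tensor_left_hom]; simp
    symm
    calc _ = 𝟙 _ ⊗≫ (cup A ▷ A ≫ _ ◁ (μ[A])†) ⊗≫ (dual A ◁ (β_ A A).hom ≫ (α_ _ _ _).inv ≫
          (β_ (dual A) A).hom ▷ A) ▷ A ⊗≫ A ◁ (dual A ◁ μ[A]) := by
          refine Eq.trans (b := 𝟙 _ ⊗≫ (cup A ▷ A ≫ _ ◁ (μ[A])†) ⊗≫ (dual A ◁ (β_ A A).hom) ▷ A ⊗≫
            ((dual A ⊗ A) ◁ μ[A] ≫ (β_ (dual A) A).hom ▷ A) ⊗≫ 𝟙 _) (by monoidal) ?_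
          rw [whisker_exchange (β_ (dual A) A).hom]; monoidal
      _ = 𝟙 _ ⊗≫ 𝟙_ V ◁ (μ[A])† ⊗≫ (cup A ▷ A ≫ (β_ (dual A ⊗ A) A).hom) ▷ A ⊗≫
          A ◁ (dual A ◁ μ[A]) := by
          rw [e, ← whisker_exchange]; monoidal
      _ = _ := by
          rw [BraidedCategory.braiding_naturality_left, braiding_tensorUnit_left, coact]; monoidal
  · have e : dual A ◁ (β_ A A).hom ≫ (β_ (dual A) (A ⊗ A)).hom =
        (α_ _ _ _).inv ≫ (β_ (dual A ⊗ A) A).hom ≫ A ◁ (β_ (dual A) A).hom ≫ (α_ _ _ _).inv := by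
      rw [BraidedCategory.braiding_tensor_left_hom, BraidedCategory.braiding_tensor_right_hom]
      simp
    calc _ = 𝟙 _ ⊗≫ (cup A ▷ A ≫ _ ◁ (μ[A])†) ⊗≫ (dual A ◁ (β_ A A).hom ≫
          (dual A ◁ μ[A] ≫ (β_ (dual A) A).hom)) ▷ A ⊗≫ 𝟙 _ := by
          monoidal
      _ = 𝟙 _ ⊗≫ 𝟙_ V ◁ (μ[A])† ⊗≫ (cup A ▷ A ≫ (β_ (dual A ⊗ A) A).hom) ▷ A ⊗≫
          (A ◁ (β_ (dual A) A).hom) ▷ A ⊗≫ μ[A] ▷ (dual A ⊗ A) := by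
          rw [BraidedCategory.braiding_naturality_right, reassoc_of% e, ← whisker_exchange]
          monoidal
      _ = _ := by
          rw [BraidedCategory.braiding_naturality_left, braiding_tensorUnit_left, dag_cap]; monoidal

theorem act_coact (A : V) [MonObj A] [DaggerFrobenius A] (hA : IsNormalisable A) :
    act A ≫ coact A = kraus (μ[A])† := by
  apply bend_inj
  rw [bend_act, bend_kraus, act_coact_aux A hA, DaggerCategory.dag_dag]

theorem IsCPStar.id (A : V) [MonObj A] [DaggerFrobenius A] (hA : IsNormalisable A) :
    IsCPStar (𝟙 A) := by
  refine ⟨A, (μ[A])†, ?_⟩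
  rw [Category.id_comp, act_coact A hA]

theorem tensorμ_assoc (A₁ A₂ A₃ B₁ B₂ B₃ : V) :
    (α_ (A₁ ⊗ B₁) (A₂ ⊗ B₂) (A₃ ⊗ B₃)).hom ≫ (A₁ ⊗ B₁) ◁ tensorμ A₂ B₂ A₃ B₃ ≫
      tensorμ A₁ B₁ (A₂ ⊗ A₃) (B₂ ⊗ B₃) =
    tensorμ A₁ B₁ A₂ B₂ ▷ (A₃ ⊗ B₃) ≫ tensorμ (A₁ ⊗ A₂) (B₁ ⊗ B₂) A₃ B₃ ≫
      ((α_ A₁ A₂ A₃).hom ⊗ₘ (α_ B₁ B₂ B₃).hom) := by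
  have t := associator_monoidal A₁ A₂ A₃ B₁ B₂ B₃
  rw [← cancel_epi (tensorμ A₁ A₂ B₁ B₂ ▷ (A₃ ⊗ B₃)),
    ← cancel_epi (tensorμ (A₁ ⊗ A₂) A₃ (B₁ ⊗ B₂) B₃), reassoc_of% t,
    ← comp_whiskerRight_assoc, tensorμ_tensorμ, id_whiskerRight, Category.id_comp,
    reassoc_of% (tensorμ_tensorμ (A₁ ⊗ A₂) A₃ (B₁ ⊗ B₂) B₃), ← whiskerLeft_comp_assoc,
    tensorμ_tensorμ, whiskerLeft_id, Category.id_comp, tensorμ_tensorμ, Category.comp_id]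

theorem coact_tensor (A B : V) [MonObj A] [MonObj B] :
    coact (A ⊗ B) ≫ (resh A B).hom = coact A ⊗ₘ coact B := by
  have h1 := tensorμ_assoc (dual A) A A (dual B) B B
  have h2 := tensorμ_natural_right (dual A) (dual B) μ[A] μ[B]
  have h3 := tensorμ_natural_left (cup A) (cup B) A B
  have h4 := leftUnitor_monoidal A B
  have h5 := cup_dualTensor A B
  have h6 : (λ_ (A ⊗ B)).inv ≫ (λ_ (𝟙_ V)).inv ▷ (A ⊗ B) ≫ tensorμ (𝟙_ V) (𝟙_ V) A B =
      ((λ_ A).inv ⊗ₘ (λ_ B).inv) := by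
    rw [← cancel_mono ((λ_ A).hom ⊗ₘ (λ_ B).hom)]
    simp only [tensorHom_comp_tensorHom, Iso.inv_hom_id]
    rw [h4]
    simp only [Category.assoc]
    rw [reassoc_of% (tensorμ_tensorμ (𝟙_ V) (𝟙_ V) A B)]
    simp
  rw [coact, MonObj.tensorObj.mul_def, resh]
  simp only [Category.assoc, whiskerLeft_comp]
  rw [whisker_exchange_assoc, whisker_exchange_assoc, h2]
  have h7 : ∀ {Z : V} (w : (dual A ⊗ A ⊗ A) ⊗ (dual B ⊗ B ⊗ B) ⟶ Z),
      (λ_ (A ⊗ B)).inv ≫ cup (A ⊗ B) ▷ (A ⊗ B) ≫ (α_ _ _ _).hom ≫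
        (dualTensor A B).hom ▷ ((A ⊗ B) ⊗ (A ⊗ B)) ≫ (dual A ⊗ dual B) ◁ tensorμ A B A B ≫
        tensorμ (dual A) (dual B) (A ⊗ A) (B ⊗ B) ≫ w =
      (λ_ (A ⊗ B)).inv ≫ (cup (A ⊗ B) ≫ (dualTensor A B).hom ▷ (A ⊗ B)) ▷ (A ⊗ B) ≫
      ((α_ (dual A ⊗ dual B) (A ⊗ B) (A ⊗ B)).hom ≫ (dual A ⊗ dual B) ◁ tensorμ A B A B ≫
      tensorμ (dual A) (dual B) (A ⊗ A) (B ⊗ B)) ≫ w := by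
    intro Z w
    monoidal
  rw [h7]
  calc _ = (λ_ (A ⊗ B)).inv ≫ (cup (A ⊗ B) ≫ (dualTensor A B).hom ▷ (A ⊗ B) ≫
      tensorμ (dual A) (dual B) A B) ▷ (A ⊗ B) ≫ tensorμ (dual A ⊗ A) (dual B ⊗ B) A B ≫
      ((α_ _ _ _).hom ⊗ₘ (α_ _ _ _).hom) ≫ (dual A ◁ μ[A] ⊗ₘ dual B ◁ μ[B]) := by
        rw [h1]; simp only [comp_whiskerRight, Category.assoc]
    _ = _ := by
        rw [h5, comp_whiskerRight, Category.assoc, reassoc_of% h3, reassoc_of% h6]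
        simp only [tensorHom_comp_tensorHom, coact]

theorem act_tensor (A B : V) [MonObj A] [MonObj B] :
    (resh A B).inv ≫ act (A ⊗ B) = act A ⊗ₘ act B := by
  have h := congrArg DaggerCategory.dag (coact_tensor A B)
  simpa [dag_coact, dag_resh] using h

theorem loop_tensor (A B : V) [MonObj A] [MonObj B] :
    loop (A ⊗ B) = (loop A ⊗ₘ loop B) ≫ (λ_ _).hom := by
  rw [loop, disc_tensor, reassoc_of% (coact_tensor A B), tensorHom_comp_tensorHom_assoc, loop, loop]

theorem IsCPStar.tensor {A B A' B' : V} [MonObj A] [MonObj B] [MonObj A'] [MonObj B']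
    {f : A ⟶ B} {f' : A' ⟶ B'} (hf : IsCPStar f) (hf' : IsCPStar f') : IsCPStar (f ⊗ₘ f') := by
  have h := IsCPM.tensor hf hf'
  have e1 : act (A ⊗ A') = (resh A A').hom ≫ (act A ⊗ₘ act A') := by
    rw [← act_tensor, Iso.hom_inv_id_assoc]
  have e2 : coact (B ⊗ B') = (coact B ⊗ₘ coact B') ≫ (resh B B').inv := by
    rw [← coact_tensor, Category.assoc, Iso.hom_inv_id, Category.comp_id]
  rw [IsCPStar, e1, e2]
  simpa [cpmTensor] using h

theorem dag_mul_tensor (A B : V) [MonObj A] [MonObj B] :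
    (μ[A ⊗ B])† = ((μ[A])† ⊗ₘ (μ[B])†) ≫ tensorδ A B A B := by
  rw [MonObj.tensorObj.mul_def]; simp [dag_tensorμ]

theorem dag_one_tensor (A B : V) [MonObj A] [MonObj B] :
    (η[A ⊗ B])† = ((η[A])† ⊗ₘ (η[B])†) ≫ (λ_ _).hom := by
  rw [MonObj.tensorObj.one_def]; simp

theorem whiskerLeft_tensor {A B A' B' : V} (f : A ⟶ A') (g : B ⟶ B') (A₀ B₀ : V) :
    (A₀ ⊗ B₀) ◁ (f ⊗ₘ g) = tensorμ A₀ B₀ A B ≫ (A₀ ◁ f ⊗ₘ B₀ ◁ g) ≫ tensorμ A₀ A' B₀ B' := by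
  rw [← reassoc_of% (tensorμ_natural_right A₀ B₀ f g), tensorμ_tensorμ, Category.comp_id]

theorem whiskerRight_tensor {A B A' B' : V} (f : A ⟶ A') (g : B ⟶ B') (A₀ B₀ : V) :
    (f ⊗ₘ g) ▷ (A₀ ⊗ B₀) = tensorμ A B A₀ B₀ ≫ (f ▷ A₀ ⊗ₘ g ▷ B₀) ≫ tensorμ A' A₀ B' B₀ := by
  rw [← reassoc_of% (tensorμ_natural_left f g A₀ B₀), tensorμ_tensorμ, Category.comp_id]

instance (A B : V) [MonObj A] [MonObj B] [DaggerFrobenius A] [DaggerFrobenius B] :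
    DaggerFrobenius (A ⊗ B) where
  frobenius := by
    have hA := DaggerFrobenius.frobenius (A := A)
    have hB := DaggerFrobenius.frobenius (A := B)
    have h1 := tensorμ_assoc A A A B B B
    have e1 : (μ[A ⊗ B])† ▷ (A ⊗ B) ≫ (α_ _ _ _).hom ≫ (A ⊗ B) ◁ μ[A ⊗ B] =
        tensorμ A B A B ≫ (((μ[A])† ▷ A ≫ (α_ A A A).hom ≫ A ◁ μ[A]) ⊗ₘ
          ((μ[B])† ▷ B ≫ (α_ B B B).hom ≫ B ◁ μ[B])) ≫ tensorμ A A B B := by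
      rw [dag_mul_tensor, MonObj.tensorObj.mul_def, comp_whiskerRight, whiskerRight_tensor,
        whiskerLeft_comp, whiskerLeft_tensor μ[A] μ[B], tensorδ_eq]
      simp only [Category.assoc]
      rw [reassoc_of% h1, ← comp_whiskerRight_assoc, tensorμ_tensorμ, id_whiskerRight,
        Category.id_comp, reassoc_of% (tensorμ_tensorμ (A ⊗ A) A (B ⊗ B) B)]
      simp only [tensorHom_comp_tensorHom_assoc]
    have e2 : (A ⊗ B) ◁ (μ[A ⊗ B])† ≫ (α_ _ _ _).inv ≫ μ[A ⊗ B] ▷ (A ⊗ B) =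
        tensorμ A B A B ≫ ((A ◁ (μ[A])† ≫ (α_ A A A).inv ≫ μ[A] ▷ A) ⊗ₘ
          (B ◁ (μ[B])† ≫ (α_ B B B).inv ≫ μ[B] ▷ B)) ≫ tensorμ A A B B := by
      have h2 : tensorμ A B A B ▷ (A ⊗ B) ≫ tensorμ (A ⊗ A) (B ⊗ B) A B =
          (α_ (A ⊗ B) (A ⊗ B) (A ⊗ B)).hom ≫ (A ⊗ B) ◁ tensorμ A B A B ≫
            tensorμ A B (A ⊗ A) (B ⊗ B) ≫ ((α_ A A A).inv ⊗ₘ (α_ B B B).inv) := by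
        rw [reassoc_of% h1]; simp
      rw [dag_mul_tensor, MonObj.tensorObj.mul_def, comp_whiskerRight, whiskerRight_tensor,
        whiskerLeft_comp, whiskerLeft_tensor, tensorδ_eq]
      simp only [Category.assoc]
      rw [reassoc_of% h2, Iso.inv_hom_id_assoc, ← whiskerLeft_comp_assoc, tensorμ_tensorμ,
        whiskerLeft_id, Category.id_comp, reassoc_of% (tensorμ_tensorμ A (A ⊗ A) B (B ⊗ B))]
      simp only [tensorHom_comp_tensorHom_assoc]
    rw [e1, e2, hA, hB]

theorem IsPositive.tensor {A B : V} {f : A ⟶ A} {g : B ⟶ B} (hf : IsPositive f)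
    (hg : IsPositive g) : IsPositive (f ⊗ₘ g) := by
  obtain ⟨X, f, rfl⟩ := hf
  obtain ⟨Y, g, rfl⟩ := hg
  exact ⟨X ⊗ Y, f ⊗ₘ g, by simp⟩

theorem IsNormalisable.tensor {A B : V} [MonObj A] [MonObj B] (hA : IsNormalisable A)
    (hB : IsNormalisable B) : IsNormalisable (A ⊗ B) := by
  obtain ⟨z, hp, hi, hc, hn⟩ := hA
  obtain ⟨z', hp', hi', hc', hn'⟩ := hB
  refine ⟨z ⊗ₘ z', hp.tensor hp', inferInstance, ⟨?_, ?_⟩, ?_⟩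
  · rw [MonObj.tensorObj.mul_def, reassoc_of% (tensorμ_natural_left z z' A B)]
    simp [tensorHom_comp_tensorHom, hc.1, hc'.1]
  · rw [MonObj.tensorObj.mul_def, reassoc_of% (tensorμ_natural_right A B z z')]
    simp [tensorHom_comp_tensorHom, hc.2, hc'.2]
  · rw [loop_tensor, dag_one_tensor, ← hn, ← hn']
    simp

theorem unit_mul : μ[𝟙_ V] = (λ_ (𝟙_ V)).hom := rfl

theorem unit_one : η[𝟙_ V] = 𝟙 (𝟙_ V) := rfl

instance : DaggerFrobenius (𝟙_ V) where
  frobenius := by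
    rw [unit_mul, DaggerSymmetricCategory.dag_leftUnitor]
    monoidal

theorem isNormalisable_unit : IsNormalisable (𝟙_ V) := by
  refine ⟨𝟙 _, ⟨𝟙_ V, 𝟙 _, by simp⟩, inferInstance, ⟨by simp, by simp⟩, ?_⟩
  have h : coact (𝟙_ V) = cup (𝟙_ V) := by
    rw [coact, unit_mul]; monoidal
  rw [loop, h, cup_disc_unit, unit_one]
  simp

theorem coact_unitary {A B : V} [MonObj A] [MonObj B]
    (u : A ⟶ B) [IsMonHom u] (hu' : u† ≫ u = 𝟙 B) : coact A ≫ double u = u ≫ coact B := by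
  have h1 := cup_conj' u
  have h2 := IsMonHom.mul_hom u
  rw [hu', whiskerLeft_id, Category.comp_id] at h1
  rw [coact, coact, double]
  calc _ = (λ_ A).inv ≫ cup A ▷ A ≫ (α_ _ _ _).hom ≫ (conj u ⊗ₘ (μ[A] ≫ u)) := by
        rw [Category.assoc, Category.assoc, Category.assoc, ← id_tensorHom,
          tensorHom_comp_tensorHom, Category.id_comp]
    _ = (λ_ A).inv ≫ cup A ▷ A ≫ (α_ _ _ _).hom ≫ (conj u ⊗ₘ (u ⊗ₘ u)) ≫ dual B ◁ μ[B] := by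
        rw [h2, ← id_tensorHom, tensorHom_comp_tensorHom, Category.comp_id]
    _ = (λ_ A).inv ≫ ((cup A ≫ (conj u ⊗ₘ u)) ⊗ₘ u) ≫ (α_ _ _ _).hom ≫ dual B ◁ μ[B] := by
        rw [← associator_naturality_assoc, ← tensorHom_id, tensorHom_comp_tensorHom_assoc,
          Category.id_comp]
    _ = _ := by rw [h1, MonoidalCategory.tensorHom_def']; simp

theorem isCPStar_of_unitary {A B : V} [MonObj A] [MonObj B] [DaggerFrobenius B]
    (hB : IsNormalisable B) (u : A ⟶ B) [IsMonHom u] (hu : u ≫ u† = 𝟙 A) (hu' : u† ≫ u = 𝟙 B) :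
    IsCPStar u := by
  have h := coact_unitary u hu'
  have hd : double u ≫ double u† = 𝟙 _ := by rw [← double_comp, hu, double_id]
  have h' : act A ≫ u = double u ≫ act B := by
    have h2 : u† ≫ coact A = coact B ≫ double u† := by
      have := congrArg (fun t => u† ≫ t ≫ double u†) h
      simpa [hd, reassoc_of% hu'] using this
    apply dag_inj
    simpa [dag_act] using h2
  rw [IsCPStar, reassoc_of% h', act_coact B hB, kraus_double]
  exact ⟨_, _, rfl⟩

variable (V) in
/-- The category `CP*[V]`: its objects are the normalisable dagger Frobenius algebras in `V`, and
its morphisms are the morphisms of `V` satisfying `IsCPStar`. -/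
structure CPStar where
  obj : V
  [mon : MonObj obj]
  [frob : DaggerFrobenius obj]
  normalisable : IsNormalisable obj

attribute [instance] CPStar.mon CPStar.frob

namespace CPStar

/-- A morphism of `CP*[V]`. -/
@[ext]
structure Hom (A B : CPStar V) where
  hom : A.obj ⟶ B.obj
  isCPStar : IsCPStar hom

instance : Category (CPStar V) where
  Hom := Hom
  id A := ⟨𝟙 _, IsCPStar.id _ A.normalisable⟩
  comp {_ B _} f g := ⟨f.hom ≫ g.hom, f.isCPStar.comp B.normalisable g.isCPStar⟩

@[ext] theorem hom_ext {A B : CPStar V} {f g : A ⟶ B} (h : f.hom = g.hom) : f = g := Hom.ext h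

@[simp] theorem id_hom (A : CPStar V) : Hom.hom (𝟙 A) = 𝟙 A.obj := rfl

@[simp] theorem comp_hom {A B C : CPStar V} (f : A ⟶ B) (g : B ⟶ C) :
    (f ≫ g).hom = f.hom ≫ g.hom := rfl

/-- The tensor product of two normalisable dagger Frobenius algebras. -/
def tensor (A B : CPStar V) : CPStar V := ⟨A.obj ⊗ B.obj, A.normalisable.tensor B.normalisable⟩

variable (V) in
/-- The algebra structure on the tensor unit. -/
def unit : CPStar V := ⟨𝟙_ V, isNormalisable_unit⟩

/-- A unitary isomorphism of algebras, as an isomorphism of `CP*[V]`. -/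
def unitaryIso {A B : CPStar V} (e : A.obj ≅ B.obj) (h : IsMonHom e.hom) (he : e.hom† = e.inv) :
    A ≅ B where
  hom := ⟨e.hom, isCPStar_of_unitary B.normalisable e.hom (by rw [he]; simp) (by rw [he]; simp)⟩
  inv := ⟨e.inv, isCPStar_of_unitary A.normalisable e.inv
    (by rw [← he, DaggerCategory.dag_dag, he]; simp)
    (by rw [← he, DaggerCategory.dag_dag, he]; simp)⟩
  hom_inv_id := by ext1; simp
  inv_hom_id := by ext1; simp

instance : MonoidalCategoryStruct (CPStar V) where
  tensorObj A B := tensor A B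
  tensorHom f g := ⟨f.hom ⊗ₘ g.hom, f.isCPStar.tensor g.isCPStar⟩
  whiskerLeft A _ _ g := ⟨A.obj ◁ g.hom, by
    rw [← id_tensorHom]; exact (IsCPStar.id _ A.normalisable).tensor g.isCPStar⟩
  whiskerRight f B := ⟨f.hom ▷ B.obj, by
    rw [← tensorHom_id]; exact f.isCPStar.tensor (IsCPStar.id _ B.normalisable)⟩
  tensorUnit := unit V
  associator A B C := unitaryIso (A := tensor (tensor A B) C) (B := tensor A (tensor B C))
    (α_ A.obj B.obj C.obj) (inferInstanceAs (IsMonHom (α_ A.obj B.obj C.obj).hom))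
    (DaggerSymmetricCategory.dag_associator _ _ _)
  leftUnitor A := unitaryIso (A := tensor (unit V) A) (λ_ A.obj)
    (inferInstanceAs (IsMonHom (λ_ A.obj).hom)) (DaggerSymmetricCategory.dag_leftUnitor _)
  rightUnitor A := unitaryIso (A := tensor A (unit V)) (ρ_ A.obj)
    (inferInstanceAs (IsMonHom (ρ_ A.obj).hom)) (DaggerSymmetricCategory.dag_rightUnitor _)

variable (V) in
/-- The forgetful functor from `CP*[V]` to `V`. -/
def forget : CPStar V ⥤ V where
  obj A := A.obj
  map f := f.hom

instance : (forget V).Faithful where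
  map_injective h := hom_ext h

variable (V) in
/-- The monoidal structure of `CP*[V]` is that of `V`. -/
def inducing : Monoidal.InducingFunctorData (forget V) where
  μIso A B := Iso.refl _
  whiskerLeft_eq X _ _ f := by
    change X.obj ◁ f.hom = 𝟙 _ ≫ (X.obj ◁ f.hom) ≫ 𝟙 _
    simp
  whiskerRight_eq f X := by
    change f.hom ▷ X.obj = 𝟙 _ ≫ (f.hom ▷ X.obj) ≫ 𝟙 _
    simp
  tensorHom_eq f g := by
    change f.hom ⊗ₘ g.hom = 𝟙 _ ≫ (f.hom ⊗ₘ g.hom) ≫ 𝟙 _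
    simp
  εIso := Iso.refl _
  associator_eq X Y Z := by
    change (α_ X.obj Y.obj Z.obj).hom = (𝟙 _ ≫ (𝟙 _ ⊗ₘ 𝟙 _)) ≫ (α_ _ _ _).hom ≫
      (𝟙 _ ⊗ₘ 𝟙 _) ≫ 𝟙 _
    simp
  leftUnitor_eq X := by
    change (λ_ X.obj).hom = (𝟙 _ ≫ (𝟙 _ ⊗ₘ 𝟙 _)) ≫ (λ_ _).hom
    simp
  rightUnitor_eq X := by
    change (ρ_ X.obj).hom = (𝟙 _ ≫ (𝟙 _ ⊗ₘ 𝟙 _)) ≫ (ρ_ _).hom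
    simp

instance : MonoidalCategory (CPStar V) := Monoidal.induced (forget V) (inducing V)

instance : (forget V).Monoidal := Monoidal.fromInducedMonoidal (forget V) (inducing V)

instance : BraidedCategory (CPStar V) :=
  BraidedCategory.ofFaithful (forget V)
    (fun A B => unitaryIso (A := tensor A B) (B := tensor B A) (β_ A.obj B.obj)
      (inferInstanceAs (IsMonHom (β_ A.obj B.obj).hom)) (DaggerSymmetricCategory.dag_braiding _ _))
    (fun A B => by
      change 𝟙 _ ≫ (β_ A.obj B.obj).hom = (β_ A.obj B.obj).hom ≫ 𝟙 _
      simp)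

instance : SymmetricCategory (CPStar V) where
  symmetry A B := by
    ext1
    exact SymmetricCategory.symmetry A.obj B.obj

instance : DaggerSymmetricCategory (CPStar V) where
  dag f := ⟨f.hom†, f.isCPStar.dag⟩
  dag_id A := by ext1; simp
  dag_comp f g := by ext1; simp
  dag_dag f := by ext1; simp
  dag_tensor f g := by
    ext1
    exact DaggerSymmetricCategory.dag_tensor f.hom g.hom
  dag_associator A B C := by
    ext1
    exact DaggerSymmetricCategory.dag_associator A.obj B.obj C.obj
  dag_leftUnitor A := by
    ext1
    exact DaggerSymmetricCategory.dag_leftUnitor A.obj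
  dag_rightUnitor A := by
    ext1
    exact DaggerSymmetricCategory.dag_rightUnitor A.obj
  dag_braiding A B := by
    ext1
    exact DaggerSymmetricCategory.dag_braiding A.obj B.obj

end CPStar

variable (V) in
/-- A dagger compact category is positive-dimensional if for every object `X` there is a positive
definite scalar `z` such that `(z² ∘ Tr_X(1_X)) ⊗ 1_X = 1_X`. -/
def PositiveDimensional : Prop :=
  ∀ X : V, ∃ z : 𝟙_ V ⟶ 𝟙_ V, IsPositive z ∧ IsIso z ∧
    (λ_ X).inv ≫ (z ≫ z ≫ cup X ≫ disc X) ▷ X ≫ (λ_ X).hom = 𝟙 X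

/-- The pants algebra: the multiplication of `A* ⊗ A` applies the cap to the two middle tensor
factors of `(A* ⊗ A) ⊗ (A* ⊗ A)`, and its unit is the cup. -/
def pants (A : V) : Mon V where
  X := dbl A
  mon :=
    { one := cup A
      mul := (α_ _ _ _).hom ≫ dual A ◁ ((α_ _ _ _).inv ≫ cap A ▷ A ≫ (λ_ A).hom)
      one_mul := by
        calc _ = 𝟙 _ ⊗≫ (cup A ▷ dual A ≫ (α_ _ _ _).hom ≫ dual A ◁ cap A) ▷ A ⊗≫ 𝟙 _ := by
              monoidal
          _ = _ := by rw [snake_left]; monoidal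
      mul_one := by
        calc _ = 𝟙 _ ⊗≫ dual A ◁ (A ◁ cup A ≫ (α_ _ _ _).inv ≫ cap A ▷ A) ⊗≫ 𝟙 _ := by
              monoidal
          _ = _ := by rw [snake_right]; monoidal
      mul_assoc := by
        calc _ = 𝟙 _ ⊗≫ dual A ◁ (cap A ▷ (A ⊗ dual A) ≫ 𝟙_ V ◁ cap A) ▷ A ⊗≫ 𝟙 _ := by
              monoidal
          _ = _ := by rw [← whisker_exchange]; monoidal }

/-- The functor `CPM[V] ⥤ CP*[V]` sending `A` to the pants algebra on `A* ⊗ A` and `f` to `f`, given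
that this is well-defined on objects and on morphisms. -/
def pantsFunctor (hobj : ∀ A : V, DaggerFrobenius (pants A).X ∧ IsNormalisable (pants A).X)
    (hmap : ∀ (A B : V) (f : dbl A ⟶ dbl B), IsCPM f →
      IsCPStar (A := (pants A).X) (B := (pants B).X) f) : CPM V ⥤ CPStar V where
  obj A :=
    { obj := (pants A.obj).X
      frob := (hobj A.obj).1
      normalisable := (hobj A.obj).2 }
  map {A B} f := ⟨f.hom, hmap A.obj B.obj f.hom f.isCPM⟩
  map_id _ := rfl
  map_comp _ _ := rfl

end CPS

namespace CPS

open scoped MonObj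

section Pants

variable {V : Type u} [Category.{v} V] [MonoidalCategory V] [SymmetricCategory V]
  [LeftRigidCategory V]

/-- The pants algebra structure on `A* ⊗ A`. -/
local instance pantsMonObj (A : V) : MonObj (dbl A) := (pants A).mon

theorem pants_mul (A : V) : μ[dbl A] =
    (α_ _ _ _).hom ≫ dual A ◁ ((α_ _ _ _).inv ≫ cap A ▷ A ≫ (λ_ A).hom) := rfl

theorem pants_one (A : V) : η[dbl A] = cup A := rfl

theorem tensorμ_whiskerRight_assoc (D E F A P : V) :
    (α_ (D ⊗ E) (F ⊗ A) P).hom ≫ (D ⊗ E) ◁ (α_ F A P).hom ≫ tensorμ D E F (A ⊗ P) =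
      tensorμ D E F A ▷ P ≫ (α_ (D ⊗ F) (E ⊗ A) P).hom ≫ (D ⊗ F) ◁ (α_ E A P).hom := by
  dsimp only [tensorμ]
  monoidal

variable [DaggerCompactCategory V]

theorem coact_pants_resh (A : V) :
    coact (dbl A) ≫ (resh (dual A) A).hom =
      (λ_ (dbl A)).inv ≫ cup (dual A) ▷ dbl A := by
  have h1 := cup_dualTensor (dual A) A
  have h2 := tensorμ_whiskerRight_assoc (dual (dual A)) (dual A) (dual A) A (dbl A)
  have h3 := MonObj.one_mul (dbl A)
  rw [pants_mul, pants_one] at h3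
  set g : A ⊗ dbl A ⟶ A := (α_ _ _ _).inv ≫ cap A ▷ A ≫ (λ_ A).hom
  have h4 := tensorμ_natural_right (dual (dual A)) (dual A) (𝟙 (dual A)) g
  simp only [id_tensorHom, whiskerLeft_id] at h4
  rw [coact, pants_mul, resh]
  calc _ = (λ_ (dbl A)).inv ≫ (cup (dbl A) ≫ (dualTensor (dual A) A).hom ▷ dbl A) ▷ dbl A ≫
        (α_ _ _ _).hom ≫ _ ◁ (α_ _ _ _).hom ≫ _ ◁ dual A ◁ g ≫
          tensorμ (dual (dual A)) (dual A) (dual A) A := by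
        simp only [Category.assoc]
        rw [whisker_exchange_assoc]
        monoidal
    _ = (λ_ (dbl A)).inv ≫ (cup (dbl A) ≫ (dualTensor (dual A) A).hom ▷ dbl A ≫
          tensorμ (dual (dual A)) (dual A) (dual A) A) ▷ dbl A ≫
        (α_ _ _ _).hom ≫ _ ◁ ((α_ _ _ _).hom ≫ dual A ◁ g) := by
        rw [h4, reassoc_of% h2]; monoidal
    _ = (λ_ (dbl A)).inv ≫ cup (dual A) ▷ dbl A ≫
        (dual (dual A) ⊗ dual A) ◁ ((λ_ (dbl A)).inv ≫ cup A ▷ dbl A ≫ (α_ _ _ _).hom ≫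
          dual A ◁ g) := by
        rw [h1, MonoidalCategory.tensorHom_def]; monoidal
    _ = _ := by
        rw [h3]
        simp

theorem coact_pants (A : V) :
    coact (dbl A) =
      (λ_ (dbl A)).inv ≫ cup (dual A) ▷ dbl A ≫ (resh (dual A) A).inv := by
  rw [← reassoc_of% (coact_pants_resh A), Iso.hom_inv_id, Category.comp_id]

theorem double_leftUnitor_inv_resh (B : V) :
    double (λ_ B).inv ≫ (resh (𝟙_ V) B).hom ≫ disc (𝟙_ V) ▷ dbl B = (λ_ (dbl B)).inv := by
  rw [← cancel_mono (λ_ _).hom]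
  simp only [Category.assoc]
  rw [← resh_leftUnitor, ← double_comp]
  simp

theorem isCPM_coact_pants (A : V) : IsCPM (A := A) (B := dbl A) (coact (dbl A)) := by
  have h1 : IsCPM (disc (𝟙_ V) ≫ cup (dual A)) := ⟨_, _, (kraus_cup (dual A)).symm⟩
  have h2 := (isCPM_double (λ_ A).inv).comp (h1.tensor (IsCPM.id A))
  convert! h2 using 1
  rw [coact_pants, cpmTensor, tensorHom_id, comp_whiskerRight, Category.assoc,
    ← double_leftUnitor_inv_resh]
  simp only [Category.assoc]

theorem isCPM_act_pants (A : V) : IsCPM (A := dbl A) (B := A) (act (dbl A)) :=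
  (isCPM_coact_pants A).dag

theorem isCPStar_pants {A B : V} {f : dbl A ⟶ dbl B} (hf : IsCPM f) :
    IsCPStar (A := dbl A) (B := dbl B) f :=
  (isCPM_act_pants A).comp (hf.comp (isCPM_coact_pants B))

local instance daggerFrobenius_pants (A : V) : DaggerFrobenius (dbl A) where
  frobenius := by
    rw [pants_mul]
    simp only [DaggerCategory.dag_comp, dag_whiskerLeft, dag_whiskerRight, dag_associator_inv,
      DaggerSymmetricCategory.dag_associator, DaggerSymmetricCategory.dag_leftUnitor]
    calc _ = 𝟙 _ ⊗≫ dual A ◁ ((cap A)† ▷ (A ⊗ dual A) ≫ (A ⊗ dual A) ◁ cap A) ▷ A ⊗≫ 𝟙 _ := by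
          monoidal
      _ = 𝟙 _ ⊗≫ dual A ◁ (𝟙_ V ◁ cap A ≫ (cap A)† ▷ 𝟙_ V) ▷ A ⊗≫ 𝟙 _ := by
          rw [whisker_exchange]
      _ = 𝟙 _ ⊗≫ dual A ◁ (cap A ▷ 𝟙_ V ≫ 𝟙_ V ◁ (cap A)†) ▷ A ⊗≫ 𝟙 _ := by
          monoidal
      _ = 𝟙 _ ⊗≫ dual A ◁ ((A ⊗ dual A) ◁ (cap A)† ≫ cap A ▷ (A ⊗ dual A)) ▷ A ⊗≫ 𝟙 _ := by
          rw [← whisker_exchange]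
      _ = _ := by monoidal

theorem loop_pants (A : V) :
    loop (dbl A) = (λ_ (dbl A)).inv ≫ (cup (dual A) ≫ disc (dual A)) ▷ dbl A ≫
      (λ_ (dbl A)).hom ≫ disc A := by
  rw [loop, coact_pants, disc_tensor]
  simp only [Category.assoc, Iso.inv_hom_id_assoc]
  rw [MonoidalCategory.tensorHom_def]
  simp

theorem isPositive_scalar {s : 𝟙_ V ⟶ 𝟙_ V} (hs : IsPositive s) (A : V) :
    IsPositive ((λ_ A).inv ≫ s ▷ A ≫ (λ_ A).hom) := by
  obtain ⟨X, h, rfl⟩ := hs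
  exact ⟨X ⊗ A, (λ_ A).inv ≫ h ▷ A, by simp⟩

theorem isCentral_scalar (s : 𝟙_ V ⟶ 𝟙_ V) (A : V) [MonObj A] :
    IsCentral A ((λ_ A).inv ≫ s ▷ A ≫ (λ_ A).hom) := by
  have h : μ[A] ≫ (λ_ A).inv ≫ s ▷ A ≫ (λ_ A).hom =
      (λ_ (A ⊗ A)).inv ≫ s ▷ (A ⊗ A) ≫ (λ_ (A ⊗ A)).hom ≫ μ[A] := by
    rw [leftUnitor_inv_naturality_assoc, whisker_exchange_assoc, leftUnitor_naturality]
  refine ⟨?_, ?_⟩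
  · rw [h]; monoidal
  · rw [h]
    have e : A ◁ ((λ_ A).inv ≫ s ▷ A ≫ (λ_ A).hom) =
        ((ρ_ A).inv ≫ A ◁ s ≫ (ρ_ A).hom) ▷ A := by monoidal
    have e2 : (ρ_ A).inv ≫ A ◁ s ≫ (ρ_ A).hom = (λ_ A).inv ≫ s ▷ A ≫ (λ_ A).hom := by
      rw [← cancel_epi (ρ_ A).hom, ← cancel_mono (ρ_ A).inv]
      have b := BraidedCategory.braiding_naturality_right A s
      rw [braiding_tensorUnit_right] at b
      have b' := congrArg (fun t => t ≫ (λ_ A).hom ≫ (ρ_ A).inv) b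
      simpa using b'
    rw [e, e2]; monoidal

theorem isNormalisable_pants (hV : PositiveDimensional V) (A : V) :
    IsNormalisable (dbl A) := by
  obtain ⟨z, hp, hi, hz⟩ := hV (dual A)
  refine ⟨(λ_ (dbl A)).inv ≫ z ▷ dbl A ≫ (λ_ (dbl A)).hom, isPositive_scalar hp _,
    inferInstance, isCentral_scalar z (dbl A), ?_⟩
  rw [loop_pants, pants_one, dag_cup]
  calc _ = ((λ_ (dual A)).inv ≫ (z ≫ z ≫ cup (dual A) ≫ disc (dual A)) ▷ dual A ≫
        (λ_ (dual A)).hom) ▷ A ≫ disc A := by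
        simp only [Category.assoc, Iso.hom_inv_id_assoc]
        monoidal
    _ = _ := by rw [hz]; simp

theorem IsCPStar.isCPM_pants (hV : PositiveDimensional V) {A B : V} {f : dbl A ⟶ dbl B}
    (hf : IsCPStar (A := dbl A) (B := dbl B) f) : IsCPM f := by
  obtain ⟨z, hzp, -, hzc, hzn⟩ := isNormalisable_pants hV A
  obtain ⟨w, hwp, -, hwc, hwn⟩ := isNormalisable_pants hV B
  have hz := coact_double_act hzp.dag hzc hzn
  have hw := coact_double_act hwp.dag hwc hwn
  have h := ((isCPM_coact_pants A).comp (isCPM_double z)).comp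
    (IsCPM.comp hf ((isCPM_double w).comp (isCPM_act_pants B)))
  have e : (coact (dbl A) ≫ double z) ≫ (act (dbl A) ≫ f ≫ coact (dbl B)) ≫
      double w ≫ act (dbl B) = f := by
    simp only [Category.assoc]
    rw [hw, reassoc_of% hz]
    exact Category.comp_id f
  exact (congrArg IsCPM e).mp h

theorem isCPStar_resh (A B : V) :
    IsCPStar (A := dbl (A ⊗ B)) (B := dbl A ⊗ dbl B) (resh A B).hom := by
  have h := (isCPM_act_pants (A ⊗ B)).comp ((isCPM_coact_pants A).tensor (isCPM_coact_pants B))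
  have e : coact (dbl A ⊗ dbl B) =
      (coact (dbl A) ⊗ₘ coact (dbl B)) ≫ (resh (dbl A) (dbl B)).inv := by
    rw [← coact_tensor, Category.assoc, Iso.hom_inv_id, Category.comp_id]
  rw [IsCPStar, e]
  exact h

theorem isCPStar_disc_unit :
    IsCPStar (A := dbl (𝟙_ V)) (B := 𝟙_ V) (disc (𝟙_ V)) := by
  have h : coact (𝟙_ V) = cup (𝟙_ V) := by
    rw [coact, unit_mul]; monoidal
  rw [IsCPStar, h, disc_cup_unit]
  exact (isCPM_act_pants (𝟙_ V)).comp (IsCPM.id _)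

section Functor

variable (hobj : ∀ A : V, DaggerFrobenius (pants A).X ∧ IsNormalisable (pants A).X)
  (hmap : ∀ (A B : V) (f : dbl A ⟶ dbl B), IsCPM f →
    IsCPStar (A := (pants A).X) (B := (pants B).X) f)

/-- The reshuffling isomorphism `𝓑 (A ⊗ B) ≅ 𝓑 A ⊗ 𝓑 B` of `CP*[V]`. -/
def pantsFunctorReshIso (A B : CPM V) :
    (pantsFunctor hobj hmap).obj (A ⊗ B) ≅
      (pantsFunctor hobj hmap).obj A ⊗ (pantsFunctor hobj hmap).obj B where
  hom := ⟨(resh A.obj B.obj).hom, isCPStar_resh A.obj B.obj⟩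
  inv := ⟨(resh A.obj B.obj).inv, by
    have h := (isCPStar_resh A.obj B.obj).dag
    have e := dag_resh A.obj B.obj
    exact e ▸ h⟩
  hom_inv_id := by ext1; exact (resh A.obj B.obj).hom_inv_id
  inv_hom_id := by ext1; exact (resh A.obj B.obj).inv_hom_id

/-- The unitary isomorphism `𝓑 I ≅ I` of `CP*[V]`. -/
def pantsFunctorUnitIso : (pantsFunctor hobj hmap).obj (𝟙_ (CPM V)) ≅ 𝟙_ (CPStar V) where
  hom := ⟨disc (𝟙_ V), isCPStar_disc_unit⟩
  inv := ⟨cup (𝟙_ V), by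
    have h := (isCPStar_disc_unit (V := V)).dag
    have e := dag_disc (𝟙_ V)
    exact e ▸ h⟩
  hom_inv_id := by ext1; exact disc_cup_unit
  inv_hom_id := by ext1; exact cup_disc_unit

/-- The strong monoidal structure of `𝓑`, with coherence given by the reshuffling maps. -/
local instance pantsFunctorMonoidal : (pantsFunctor hobj hmap).Monoidal :=
  Functor.CoreMonoidal.toMonoidal
    { εIso := (pantsFunctorUnitIso hobj hmap).symm
      μIso A B := (pantsFunctorReshIso hobj hmap A B).symm
      μIso_hom_natural_left {A B} f C := by
        ext1
        change f.hom ▷ dbl C.obj ≫ (resh B.obj C.obj).inv =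
          (resh A.obj C.obj).inv ≫ cpmTensor f.hom (𝟙 (dbl C.obj))
        simp [cpmTensor]
      μIso_hom_natural_right {A B} C f := by
        ext1
        change dbl C.obj ◁ f.hom ≫ (resh C.obj B.obj).inv =
          (resh C.obj A.obj).inv ≫ cpmTensor (𝟙 (dbl C.obj)) f.hom
        simp [cpmTensor]
      associativity A B C := by
        ext1
        exact Functor.LaxMonoidal.associativity (doubling V) A.obj B.obj C.obj
      left_unitality A := by
        ext1
        exact Functor.LaxMonoidal.left_unitality (doubling V) A.obj
      right_unitality A := by
        ext1
        exact Functor.LaxMonoidal.right_unitality (doubling V) A.obj }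

/-- The functor `𝓑` is symmetric monoidal. -/
local instance pantsFunctorBraided : (pantsFunctor hobj hmap).Braided where
  braided A B := by
    ext1
    exact Functor.LaxBraided.braided (F := doubling V) A.obj B.obj

end Functor

end Pants

end CPS

theorem mainTheorem5 {V : Type u} [Category.{v} V] [MonoidalCategory V] [SymmetricCategory V]
    [LeftRigidCategory V] [DaggerCompactCategory V] (hV : CPS.PositiveDimensional V) :
    ∃ (hobj : ∀ A : V, CPS.DaggerFrobenius (CPS.pants A).X ∧ CPS.IsNormalisable (CPS.pants A).X)
      (hmap : ∀ (A B : V) (f : CPS.dbl A ⟶ CPS.dbl B), CPS.IsCPM f →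
        CPS.IsCPStar (A := (CPS.pants A).X) (B := (CPS.pants B).X) f),
      (CPS.pantsFunctor hobj hmap).Full ∧
      (CPS.pantsFunctor hobj hmap).Faithful ∧
      (∀ {A B : CPS.CPM V} (f : A ⟶ B),
        (CPS.pantsFunctor hobj hmap).map f† = ((CPS.pantsFunctor hobj hmap).map f)†) ∧
      ∃ _ : (CPS.pantsFunctor hobj hmap).Braided,
        (∀ A B : CPS.CPM V,
          (Functor.OplaxMonoidal.δ (CPS.pantsFunctor hobj hmap) A B).hom =
              (CPS.resh A.obj B.obj).hom ∧
            (Functor.OplaxMonoidal.δ (CPS.pantsFunctor hobj hmap) A B)† =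
              Functor.LaxMonoidal.μ (CPS.pantsFunctor hobj hmap) A B) ∧
        (Functor.OplaxMonoidal.η (CPS.pantsFunctor hobj hmap)).hom = CPS.disc (𝟙_ V) ∧
        (Functor.OplaxMonoidal.η (CPS.pantsFunctor hobj hmap))† =
          Functor.LaxMonoidal.ε (CPS.pantsFunctor hobj hmap) := by
  have hobj : ∀ A : V, CPS.DaggerFrobenius (CPS.pants A).X ∧ CPS.IsNormalisable (CPS.pants A).X :=
    fun A => ⟨CPS.daggerFrobenius_pants A, CPS.isNormalisable_pants hV A⟩
  refine ⟨hobj, fun A B f hf => CPS.isCPStar_pants hf, ⟨?_⟩, ⟨?_⟩, fun f => rfl,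
    CPS.pantsFunctorBraided hobj _,
    fun A B => ⟨rfl, ?_⟩, rfl, ?_⟩
  · exact fun f => ⟨⟨f.hom, CPS.IsCPStar.isCPM_pants hV f.isCPStar⟩, rfl⟩
  · intro A B f g h
    ext1
    exact congrArg CPS.CPStar.Hom.hom h
  · apply CPS.CPStar.hom_ext
    exact CPS.dag_resh A.obj B.obj
  · apply CPS.CPStar.hom_ext
    exact CPS.dag_disc (𝟙_ V)
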